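/- Let $R$ be a Noetherian local normal domain of dimension two, with maximal ideal $\mathfrak m$, such that its $\mathfrak m$-adic completion $\hat R$ is also a normal domain. Assume that the cokernel $G$ of the natural homomorphism of divisor class groups $\operatorname{Cl}(R)\to\operatorname{Cl}(\hat R)$, $[I]\mapsto[I\hat R]$, is finite. Let $\operatorname{D}(G)$ be the Davenport constant of $G$, i.e. the least positive integer $d$ such that every sequence of $d$ (not necessarily distinct) elements of $G$ has a non-empty subsequence whose sum is $0$. A finitely generated nonzero module $M$ over a Noetherian local ring $A$ is called maximal Cohen–Macaulay (MCM) if $\operatorname{depth}M=\dim A$. 1. For every natural number $n$: if every indecomposable MCM $\hat R$-module has rank at most $n$, then every indecomposable MCM $R$-module has rank at most $n\cdot\operatorname{D}(G)$. 2. If $\hat R$ has bounded Cohen–Macaulay type, then so has $R$. Here a local ring has bounded Cohen–Macaulay type if there is a bound on the Hilbert–Samuel multiplicities of its indecomposable MCM modules. -/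

import Mathlib

open scoped nonZeroDivisors

universe u

section DivisorialFractionalIdeals

open FractionalIdeal

variable {A : Type u} [CommRing A] [IsDomain A]

theorem fracIdeal_inv_ne_zero {I : FractionalIdeal A⁰ (FractionRing A)} (hI : I ≠ 0) :
    I⁻¹ ≠ 0 := by
  intro h
  have := bot_lt_mul_inv (I := I) (by simpa using hI)
  simp [h] at this

theorem fracIdeal_singleton_ne_zero {x : FractionRing A} (hx : x ≠ 0) :
    spanSingleton A⁰ x ≠ 0 := by
  rwa [Ne, spanSingleton_eq_zero_iff]

theorem fracIdeal_mul_ne_zero {I L : FractionalIdeal A⁰ (FractionRing A)} (hI : I ≠ 0)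
    (hL : L ≠ 0) : I * L ≠ 0 := by
  intro h
  rw [ne_eq, eq_zero_iff, not_forall] at hI hL
  obtain ⟨i, hi⟩ := hI
  obtain ⟨l, hl⟩ := hL
  rw [Classical.not_imp] at hi hl
  have := mul_mem_mul hi.1 hl.1
  rw [h, mem_zero_iff] at this
  exact (mul_ne_zero hi.2 hl.2) this

theorem fracIdeal_mem_mul_inv {I L : FractionalIdeal A⁰ (FractionRing A)} (hI : I ≠ 0)
    (hL : L ≠ 0) (y : FractionRing A) : y ∈ (I * L)⁻¹ ↔ ∀ l ∈ L, y * l ∈ I⁻¹ := by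
  rw [mem_inv_iff (fracIdeal_mul_ne_zero hI hL)]
  constructor
  · intro h l hl
    rw [mem_inv_iff hI]
    intro i hi
    have := h _ (mul_mem_mul hi hl)
    rwa [mul_assoc, mul_comm l]
  · intro h z hz
    have : I * L ≤ 1 / spanSingleton A⁰ y ∨ y = 0 := by
      by_cases hy : y = 0
      · exact Or.inr hy
      · left
        rw [mul_le]
        intro i hi l hl
        have h1 := (mem_inv_iff hI).1 (h l hl) i hi
        rw [mem_div_iff_of_ne_zero (fracIdeal_singleton_ne_zero hy)]
        intro w hw
        obtain ⟨a, rfl⟩ := (mem_spanSingleton _).1 hw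
        have h2 : (i * l) * (a • y) = a • (y * l * i) := by
          rw [mul_smul_comm]; congr 1; ring
        rw [h2]
        exact Submodule.smul_mem (1 : FractionalIdeal A⁰ (FractionRing A)).coeToSubmodule a h1
    rcases this with h1 | rfl
    · by_cases hy : y = 0
      · rw [hy, zero_mul]; exact Submodule.zero_mem (FractionalIdeal.coeToSubmodule _)
      · have := (mem_div_iff_of_ne_zero (fracIdeal_singleton_ne_zero hy)).1 (h1 hz) y
          (mem_spanSingleton_self _ _)
        rwa [mul_comm]
    · rw [zero_mul]; exact Submodule.zero_mem (FractionalIdeal.coeToSubmodule _)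

theorem fracIdeal_singleton_mul_inv {x : FractionRing A} (hx : x ≠ 0)
    (I : FractionalIdeal A⁰ (FractionRing A)) :
    (spanSingleton A⁰ x * I)⁻¹ = spanSingleton A⁰ x⁻¹ * I⁻¹ := by
  by_cases hI : I = 0
  · simp [hI, inv_zero']
  · ext y
    rw [mul_comm, fracIdeal_mem_mul_inv hI (fracIdeal_singleton_ne_zero hx), mem_singleton_mul]
    constructor
    · intro h
      exact ⟨y * x, h x (mem_spanSingleton_self _ _), by field_simp⟩
    · rintro ⟨z, hz, rfl⟩ l hl
      obtain ⟨a, rfl⟩ := (mem_spanSingleton _).1 hl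
      have h2 : x⁻¹ * z * (a • x) = a • z := by
        rw [mul_smul_comm]; congr 1; field_simp
      rw [h2]
      exact Submodule.smul_mem I⁻¹.coeToSubmodule a hz

theorem fracIdeal_inv_inv_inv (I : FractionalIdeal A⁰ (FractionRing A)) :
    I⁻¹⁻¹⁻¹ = I⁻¹ := by
  by_cases hI : I = 0
  · simp [hI, inv_zero']
  · have h1 := fracIdeal_inv_ne_zero hI
    have h2 := fracIdeal_inv_ne_zero h1
    have key : ∀ {J : FractionalIdeal A⁰ (FractionRing A)}, J ≠ 0 → J ≤ J⁻¹⁻¹ := by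
      intro J hJ x hx
      refine (mem_inv_iff (fracIdeal_inv_ne_zero hJ)).2 ?_
      intro y hy
      rw [mul_comm]
      exact (mem_inv_iff hJ).1 hy x hx
    exact le_antisymm (inv_anti_mono hI h2 (key hI)) (key h1)

/-- `I` and `J` are related when their divisorial hulls `(A : (A : I))` and `(A : (A : J))`
differ by a principal factor `x ≠ 0`. -/
def DivisorialEquiv (I J : FractionalIdeal A⁰ (FractionRing A)) : Prop :=
  ∃ x : FractionRing A, x ≠ 0 ∧ I⁻¹⁻¹ = spanSingleton A⁰ x * J⁻¹⁻¹

theorem divisorialEquiv_iff (I J : FractionalIdeal A⁰ (FractionRing A)) :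
    DivisorialEquiv I J ↔ ∃ x : FractionRing A, x ≠ 0 ∧ I⁻¹ = spanSingleton A⁰ x * J⁻¹ := by
  constructor
  · rintro ⟨x, hx, h⟩
    refine ⟨x⁻¹, inv_ne_zero hx, ?_⟩
    rw [← fracIdeal_inv_inv_inv I, h, fracIdeal_singleton_mul_inv hx, fracIdeal_inv_inv_inv]
  · rintro ⟨x, hx, h⟩
    exact ⟨x⁻¹, inv_ne_zero hx, by rw [h, fracIdeal_singleton_mul_inv hx]⟩

theorem divisorialEquiv_refl (I : FractionalIdeal A⁰ (FractionRing A)) : DivisorialEquiv I I :=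
  ⟨1, one_ne_zero, by simp⟩

theorem divisorialEquiv_symm {I J : FractionalIdeal A⁰ (FractionRing A)}
    (h : DivisorialEquiv I J) : DivisorialEquiv J I := by
  obtain ⟨x, hx, h⟩ := h
  exact ⟨x⁻¹, inv_ne_zero hx, by
    rw [h, ← mul_assoc, spanSingleton_mul_spanSingleton, inv_mul_cancel₀ hx]; simp⟩

theorem divisorialEquiv_trans {I J L : FractionalIdeal A⁰ (FractionRing A)}
    (h : DivisorialEquiv I J) (h' : DivisorialEquiv J L) : DivisorialEquiv I L := by
  obtain ⟨x, hx, h⟩ := h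
  obtain ⟨y, hy, h'⟩ := h'
  exact ⟨x * y, mul_ne_zero hx hy, by
    rw [h, h', ← mul_assoc, spanSingleton_mul_spanSingleton]⟩

theorem divisorialEquiv_mul_right {I J : FractionalIdeal A⁰ (FractionRing A)}
    (h : DivisorialEquiv I J) (L : FractionalIdeal A⁰ (FractionRing A)) :
    DivisorialEquiv (I * L) (J * L) := by
  by_cases hL : L = 0
  · simpa [hL] using divisorialEquiv_refl _
  rw [divisorialEquiv_iff] at h
  obtain ⟨x, hx, h⟩ := h
  by_cases hI : I = 0
  · have hJ : J = 0 := by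
      by_contra hJ
      rw [hI, inv_zero'] at h
      exact fracIdeal_mul_ne_zero (fracIdeal_singleton_ne_zero hx) (fracIdeal_inv_ne_zero hJ) h.symm
    rw [hI, hJ]; exact divisorialEquiv_refl _
  by_cases hJ : J = 0
  · rw [hJ, inv_zero', mul_zero] at h
    exact absurd h (fracIdeal_inv_ne_zero hI)
  rw [divisorialEquiv_iff]
  refine ⟨x, hx, ?_⟩
  ext y
  rw [fracIdeal_mem_mul_inv hI hL, h, mem_singleton_mul]
  constructor
  · intro hy
    refine ⟨x⁻¹ * y, ?_, by field_simp⟩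
    rw [fracIdeal_mem_mul_inv hJ hL]
    intro l hl
    obtain ⟨z, hz, hz'⟩ := (mem_singleton_mul).1 (hy l hl)
    have : x⁻¹ * y * l = z := by rw [mul_assoc, hz']; field_simp
    rwa [this]
  · rintro ⟨z, hz, rfl⟩ l hl
    rw [mem_singleton_mul]
    exact ⟨z * l, (fracIdeal_mem_mul_inv hJ hL z).1 hz l hl, by ring⟩

variable (A)

/-- `DivisorialEquiv` is compatible with multiplication of fractional ideals. -/
def divisorialCon : Con (FractionalIdeal A⁰ (FractionRing A)) where
  r := DivisorialEquiv
  iseqv := ⟨divisorialEquiv_refl, divisorialEquiv_symm, divisorialEquiv_trans⟩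
  mul' {I J L M} h h' := by
    have h1 := divisorialEquiv_mul_right h L
    have h2 := divisorialEquiv_mul_right h' J
    rw [mul_comm L, mul_comm M] at h2
    exact divisorialEquiv_trans h1 h2

/-- The divisor class group `Cl(A)`: classes of fractional ideals, where `I` and `J` have the same
class when their divisorial hulls agree up to a nonzero principal factor, with the product induced
by that of fractional ideals. Equivalently: divisorial fractional ideals modulo principal ones,
under the product `((I * J)⁻¹)⁻¹`.

Taking units discards the class of the zero ideal. For a Noetherian normal domain, it discards
nothing else (`isUnit_divisorialClass`), so there `Cl(A)` is the usual divisor class group. -/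
def DivisorClassGroup : Type u := (divisorialCon A).Quotientˣ

instance : CommGroup (DivisorClassGroup A) :=
  inferInstanceAs (CommGroup (divisorialCon A).Quotientˣ)

variable {A}

/-- Over a Noetherian normal domain the class of every nonzero fractional ideal belongs to the
divisor class group; its inverse is the class of `(A : I)`. -/
theorem isUnit_divisorialClass [IsNoetherianRing A] [IsIntegrallyClosed A]
    {I : FractionalIdeal A⁰ (FractionRing A)} (hI : I ≠ 0) :
    IsUnit ((I : (divisorialCon A).Quotient)) := by
  refine IsUnit.of_mul_eq_one ((I⁻¹ : FractionalIdeal A⁰ (FractionRing A)) :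
    (divisorialCon A).Quotient) ?_
  rw [← Con.coe_mul, ← Con.coe_one, Con.eq]
  change DivisorialEquiv (I * I⁻¹) 1
  rw [divisorialEquiv_iff]
  refine ⟨1, one_ne_zero, ?_⟩
  have h1 := fracIdeal_inv_ne_zero hI
  simp only [spanSingleton_one, one_mul, inv_one]
  ext y
  rw [fracIdeal_mem_mul_inv hI h1]
  constructor
  · intro h
    have hint : IsIntegral A y := by
      refine isIntegral_of_smul_mem_submodule (I⁻¹).coeToSubmodule ?_ ?_ y ?_
      · intro hbot
        exact h1 (coeToSubmodule_injective (hbot.trans coe_zero.symm))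
      · exact fg_of_isNoetherianRing le_rfl _
      · intro n hn
        exact h n hn
    obtain ⟨a, rfl⟩ := IsIntegrallyClosed.isIntegral_iff.1 hint
    exact (mem_one_iff _).2 ⟨a, rfl⟩
  · intro h l hl
    obtain ⟨a, rfl⟩ := (mem_one_iff _).1 h
    rw [← Algebra.smul_def]
    exact Submodule.smul_mem I⁻¹.coeToSubmodule a hl

end DivisorialFractionalIdeals

section FlatExtension

open FractionalIdeal

variable {A B : Type u} [CommRing A] [IsDomain A] [IsNoetherianRing A]
  [CommRing B] [IsDomain B] [Algebra A B] [Module.Flat A B]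

/-- Flatness: if `b * x i ∈ c * B` for all `i`, then `b` is a `B`-combination of elements `r` of
`A` with `r * x i ∈ c * A` for all `i`. -/
theorem flat_colon {k : ℕ} (x : Fin k → A) (c : A) (b : B) (d : Fin k → B)
    (h : ∀ i, algebraMap A B (x i) * b = algebraMap A B c * d i) :
    b ∈ Submodule.span B (algebraMap A B '' {r : A | ∀ i, c ∣ x i * r}) := by
  let f : (Fin k → A) →ₗ[A] A × (Fin k → A) :=
    LinearMap.prod (∑ i, (x i) • LinearMap.proj i) ((-c) • LinearMap.id)
  let g : A × (Fin k → A) →ₗ[A] B :=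
    LinearMap.coprod (LinearMap.toSpanSingleton A B b)
      (∑ i, (LinearMap.toSpanSingleton A B (d i)) ∘ₗ LinearMap.proj i)
  have hgf : g ∘ₗ f = 0 := by
    ext i
    have := h i
    simp [f, g, Pi.single_apply, Algebra.smul_def, this, apply_ite (algebraMap A B), ite_mul]
  obtain ⟨m, a, y, hya, haf⟩ := Module.Flat.exists_factorization_of_comp_eq_zero_of_free hgf
  have hb : b = ∑ j, a (1, 0) j • y (Finsupp.single j 1) := by
    have h1 : b = g (1, 0) := by simp [g]
    rw [h1, hya, LinearMap.comp_apply]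
    conv_lhs => rw [← Finsupp.univ_sum_single (a (1, 0))]
    rw [map_sum]
    refine Finset.sum_congr rfl fun j _ => ?_
    rw [← map_smul, Finsupp.smul_single_one]
  rw [hb]
  refine Submodule.sum_mem _ fun j _ => ?_
  rw [Algebra.smul_def, mul_comm]
  refine Submodule.smul_mem _ (y (Finsupp.single j 1)) (Submodule.subset_span ⟨_, fun i => ?_, rfl⟩)
  have h2 : a (f (Pi.single i 1)) = 0 := LinearMap.congr_fun haf (Pi.single i 1)
  have h3 : f (Pi.single i 1) = x i • ((1 : A), (0 : Fin k → A))
      - c • ((0 : A), (Pi.single i 1 : Fin k → A)) := by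
    ext <;> simp [f, Pi.single_apply]
  rw [h3, map_sub, map_smul, map_smul, sub_eq_zero] at h2
  have h4 := DFunLike.congr_fun h2 j
  exact ⟨a (0, Pi.single i 1) j, by simpa using h4⟩

variable (B) in
/-- For a flat extension, `(A : I) B = (B : I B)`. -/
theorem extended_inv (I : FractionalIdeal A⁰ (FractionRing A)) :
    extendedHom (FractionRing B) B I⁻¹ = (extendedHom (FractionRing B) B I)⁻¹ := by
  have hinj := FaithfulSMul.algebraMap_injective A B
  have key : ∀ 𝔞 : Ideal A, 𝔞 ≠ ⊥ →
      extendedHom (FractionRing B) B (𝔞 : FractionalIdeal A⁰ (FractionRing A))⁻¹ =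
        (extendedHom (FractionRing B) B (𝔞 : FractionalIdeal A⁰ (FractionRing A)))⁻¹ := by
    intro 𝔞 h𝔞
    have h0 : (𝔞 : FractionalIdeal A⁰ (FractionRing A)) ≠ 0 := by simpa using h𝔞
    have h0' : extendedHom (FractionRing B) B (𝔞 : FractionalIdeal A⁰ (FractionRing A)) ≠ 0 :=
      (extendedHom_eq_zero_iff _ _).not.2 h0
    apply le_antisymm
    · rw [inv_eq, inv_eq, le_div_iff_mul_le h0', ← map_mul]
      refine extended_le_one_of_le_one _ _ _ ?_
      rw [mul_comm]; exact mul_one_div_le_one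
    · intro y hy
      obtain ⟨k, x, hx⟩ := (Submodule.fg_iff_exists_fin_generating_family (N := 𝔞)).1
        (IsNoetherian.noetherian 𝔞)
      obtain ⟨c, hc, hc0⟩ := Submodule.exists_mem_ne_zero_of_ne_bot h𝔞
      have hmem : ∀ r ∈ 𝔞, ∃ d : B, algebraMap B (FractionRing B) d
          = y * algebraMap B (FractionRing B) (algebraMap A B r) := by
        intro r hr
        have h1 := (mem_inv_iff h0').1 hy (algebraMap B (FractionRing B) (algebraMap A B r)) (by
          rw [extendedHom_coeIdeal_eq_map]
          exact mem_coeIdeal_of_mem _ (Ideal.mem_map_of_mem _ hr))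
        obtain ⟨d, hd⟩ := (mem_one_iff _).1 h1
        exact ⟨d, hd⟩
      obtain ⟨b, hb⟩ := hmem c hc
      have hxm : ∀ i, x i ∈ 𝔞 := fun i => hx ▸ Submodule.subset_span ⟨i, rfl⟩
      choose d hd using fun i => hmem (x i) (hxm i)
      have hcB : algebraMap B (FractionRing B) (algebraMap A B c) ≠ 0 := by
        simpa [hinj.eq_iff' (map_zero _)] using hc0
      have hspan := flat_colon x c b d (fun i => by
        apply IsFractionRing.injective B (FractionRing B)
        rw [map_mul, map_mul, hb, hd]; ring)
      have hy' : y = b • (algebraMap B (FractionRing B) (algebraMap A B c))⁻¹ := by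
        rw [Algebra.smul_def, hb]; field_simp
      rw [hy']
      clear hy' hb hd
      induction hspan using Submodule.span_induction with
      | zero => rw [zero_smul]; exact Submodule.zero_mem (FractionalIdeal.coeToSubmodule _)
      | add u v _ _ hu hv =>
        rw [add_smul]; exact Submodule.add_mem (FractionalIdeal.coeToSubmodule _) hu hv
      | smul t u _ hu =>
        rw [smul_assoc]
        exact Submodule.smul_mem (FractionalIdeal.coeToSubmodule _) t hu
      | mem u hu =>
        obtain ⟨r, hr, rfl⟩ := hu
        have hcA : algebraMap A (FractionRing A) c ≠ 0 := by simpa using hc0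
        have hr' : algebraMap A (FractionRing A) r * (algebraMap A (FractionRing A) c)⁻¹ ∈
            (𝔞 : FractionalIdeal A⁰ (FractionRing A))⁻¹ := by
          rw [mem_inv_iff h0]
          intro z hz
          obtain ⟨z, hz', rfl⟩ := (mem_coeIdeal _).1 hz
          have hz2 : c ∣ z * r := by
            clear hz
            rw [← hx] at hz'
            induction hz' using Submodule.span_induction with
            | zero => simp
            | add u v _ _ hu hv => rw [add_mul]; exact dvd_add hu hv
            | smul t u _ hu => rw [smul_eq_mul, mul_assoc]; exact hu.mul_left t
            | mem u hu => obtain ⟨i, rfl⟩ := hu; exact hr i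
          obtain ⟨e, he⟩ := hz2
          refine (mem_one_iff _).2 ⟨e, ?_⟩
          have := congrArg (algebraMap A (FractionRing A)) he
          rw [map_mul, map_mul] at this
          field_simp
          rw [mul_comm, ← this]; ring
        rw [extendedHom'_apply, ← mem_coe, coe_extended_eq_span]
        refine Submodule.subset_span ⟨_, hr', ?_⟩
        rw [map_mul, map_inv₀, IsLocalization.map_eq, IsLocalization.map_eq, Algebra.smul_def]
  by_cases hI : I = 0
  · simp [hI, inv_zero', -extendedHom'_apply]
  · have hden : algebraMap A (FractionRing A) (I.den : A) ≠ 0 := by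
      simp
    have hnum : I.num ≠ ⊥ := by
      intro h; exact hI (num_eq_zero_iff.1 h)
    have h1 := den_mul_self_eq_num' A⁰ (FractionRing A) I
    have h2 : I = spanSingleton A⁰ (algebraMap A (FractionRing A) (I.den : A))⁻¹ *
        (I.num : FractionalIdeal A⁰ (FractionRing A)) := by
      rw [← h1, ← mul_assoc, spanSingleton_mul_spanSingleton, inv_mul_cancel₀ hden]; simp
    rw [h2, fracIdeal_singleton_mul_inv (inv_ne_zero hden), map_mul, map_mul, key _ hnum,
      extendedHom_spanSingleton, extendedHom_spanSingleton, fracIdeal_singleton_mul_inv, map_inv₀]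
    rw [map_inv₀]
    exact inv_ne_zero (by simp)

variable (A B) in
/-- The natural homomorphism `Cl(A) → Cl(B)`, `[I] ↦ [I B]`, for a flat extension of domains. -/
noncomputable def DivisorClassGroup.map : DivisorClassGroup A →* DivisorClassGroup B :=
  Units.map ((divisorialCon A).lift
    ((divisorialCon B).mk'.comp
      (extendedHom (K := FractionRing A) (FractionRing B) B).toMonoidHom) (by
    intro I J h
    obtain ⟨x, hx, h⟩ := (divisorialEquiv_iff I J).1 h
    refine (Con.eq _).2 ((divisorialEquiv_iff _ _).2 ?_)
    refine ⟨IsFractionRing.map (FaithfulSMul.algebraMap_injective A B) x, ?_, ?_⟩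
    · simpa using hx
    · change (extendedHom (FractionRing B) B I)⁻¹ = _ * (extendedHom (FractionRing B) B J)⁻¹
      rw [← extended_inv, h, map_mul, extendedHom_spanSingleton, extended_inv]))

end FlatExtension

section Modules

/-- `M` is nonzero and is not the direct sum of two nonzero submodules. -/
def IsIndecomposableModule (A M : Type u) [CommRing A] [AddCommGroup M] [Module A M] : Prop :=
  Nontrivial M ∧ ∀ N P : Submodule A M, IsCompl N P → N = ⊥ ∨ P = ⊥

/-- `M` is a maximal Cohen--Macaulay module over the local ring `A`: it is nonzero, finitely
generated, and the maximal ideal contains an `M`-regular sequence of length `dim A` (so that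
`depth M = dim A`, as the depth never exceeds the dimension). -/
def IsMCM (A M : Type u) [CommRing A] [IsLocalRing A] [AddCommGroup M] [Module A M] : Prop :=
  Module.Finite A M ∧ Nontrivial M ∧
    ∃ rs : List A, (∀ r ∈ rs, r ∈ IsLocalRing.maximalIdeal A) ∧
      RingTheory.Sequence.IsRegular M rs ∧ (rs.length : WithBot ℕ∞) = ringKrullDim A

/-- `M` has constant rank `r`: `K ⊗ M ≅ K ^ r`, with `K` the total quotient ring of `A`. -/
def HasRank (A M : Type u) [CommRing A] [AddCommGroup M] [Module A M] (r : ℕ) : Prop :=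
  Nonempty (TensorProduct A (FractionRing A) M ≃ₗ[FractionRing A] (Fin r → FractionRing A))

/-- All indecomposable maximal Cohen--Macaulay `A`-modules have rank at most `n`. (Every finitely
generated module is isomorphic to one in the universe of `A`.) -/
def MCMRankBound (A : Type u) [CommRing A] [IsLocalRing A] (n : ℕ) : Prop :=
  ∀ (M : Type u) [AddCommGroup M] [Module A M],
    IsMCM A M → IsIndecomposableModule A M → ∃ r ≤ n, HasRank A M r

open scoped ENNReal in
/-- The (Hilbert--Samuel) multiplicity `e(M) = lim_n d! * length(M / 𝔪 ^ n M) / n ^ d`, where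
`d = dim A`. For a finitely generated module over a Noetherian local ring the limit exists; it is
written as an upper limit, which is then the same number. -/
noncomputable def hilbertSamuelMultiplicity (A M : Type u) [CommRing A] [IsLocalRing A]
    [AddCommGroup M] [Module A M] : ℝ≥0∞ :=
  let d : ℕ := ((ringKrullDim A).unbotD 0).toNat
  Filter.limsup (fun n : ℕ =>
    (d.factorial : ℝ≥0∞) *
      ((Module.length A (M ⧸ (IsLocalRing.maximalIdeal A ^ n • (⊤ : Submodule A M))) : ℕ∞) : ℝ≥0∞)
        / (n : ℝ≥0∞) ^ d) Filter.atTop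

/-- `A` has bounded Cohen--Macaulay type: the multiplicities of the indecomposable maximal
Cohen--Macaulay modules are bounded by some natural number. -/
def HasBoundedCMType (A : Type u) [CommRing A] [IsLocalRing A] : Prop :=
  ∃ b : ℕ, ∀ (M : Type u) [AddCommGroup M] [Module A M],
    IsMCM A M → IsIndecomposableModule A M → hilbertSamuelMultiplicity A M ≤ b

end Modules

/-- The Davenport constant of an abelian group `G`, written multiplicatively: the least positive
`d` such that every sequence of `d` elements has a nonempty subsequence with trivial product.
For finite `G` such `d` exists. -/
noncomputable def davenportConstant (G : Type*) [CommGroup G] : ℕ :=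
  sInf {d : ℕ | 0 < d ∧ ∀ s : Fin d → G, ∃ T : Finset (Fin d), T.Nonempty ∧ ∏ i ∈ T, s i = 1}

/-- The completion of a local ring with respect to its maximal ideal. -/
abbrev LocalCompletion (R : Type u) [CommRing R] [IsLocalRing R] : Type u :=
  AdicCompletion (IsLocalRing.maximalIdeal R) R

/-- The cokernel of the natural map `Cl(A) → Cl(B)`. -/
abbrev DivisorClassCokernel (A B : Type u) [CommRing A] [IsDomain A] [IsNoetherianRing A]
    [CommRing B] [IsDomain B] [Algebra A B] [Module.Flat A B] : Type u :=
  DivisorClassGroup B ⧸ (DivisorClassGroup.map A B).range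

/-! ### Primes of codimension one in a two-dimensional normal local domain. -/

section CodimensionOne

open IsLocalRing

/-! Write `S` for the completion of `R` and `G` for the cokernel of `Cl(R) → Cl(S)`. Let `M` be an
indecomposable MCM `R`-module. Then `S ⊗ M` is MCM and splits into indecomposable MCM `S`-modules,
and the point is that there are at most `D(G)` of them (`card_le_davenportConstant`). The bounds on
rank and multiplicity follow, since ranks and the lengths of `N / 𝔪 ^ n N` are subadditive over the
summands.

Given more than `D(G)` summands, some nonempty proper subfamily has a sum `N` whose class comes from
`Cl(R)`. By `isExtended_of_hasFlag` such an `N` is the base change of an `R`-module. Approximating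
the inclusion and the projection of `N` modulo `𝔪` by maps over `R` then splits `M` nontrivially
(`eq_bot_or_eq_bot_of_isExtended`), a contradiction.

It remains to see why the class decides whether a torsion-free `S`-module is extended. Such a module
has a filtration by ideals, and the product of their classes plays the role of the determinant. An
ideal `J` whose class comes from `Cl(R)` contains `𝔪 ^ n` times an extended divisorial ideal, its
reflexive hull up to scaling, and is therefore extended (`isExtended_of_idealClass_eq`). In a longer
filtration the two bottom ideals `J₁`, `J₂` can be traded for one of trivial class and one of class
`[J₁ J₂]` (`exists_extension_of_extension`). The first is extended, and dividing by it shortens the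
filtration without changing the class. The pieces are reassembled by `IsExtended.of_extension`:
torsion-free `R`-modules are projective on the punctured spectrum, so the relevant `Ext¹` is killed
by a power of `𝔪` and completion creates no new extensions. -/

theorem exists_notMem_smul_mem {A M : Type*} [CommRing A] [AddCommGroup M] [Module A M]
    {q : Ideal A} (hq : q.IsPrime) {N P : Submodule A M} (hN : N.FG)
    (h : ∀ x ∈ N, ∃ s ∉ q, s • x ∈ P) : ∃ s ∉ q, ∀ x ∈ N, s • x ∈ P := by
  classical
  obtain ⟨T, rfl⟩ := hN
  choose! s hs hsP using h
  have hT : ∀ t ∈ T, t ∈ Submodule.span A (T : Set M) := fun t ht => Submodule.subset_span ht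
  refine ⟨∏ t ∈ T, s t, fun hmem => ?_, fun x hx => ?_⟩
  · obtain ⟨t, ht, hst⟩ := (Ideal.IsPrime.prod_mem_iff).1 hmem
    exact hs t (hT t ht) hst
  · induction hx using Submodule.span_induction with
    | zero => simp
    | add x y _ _ hx hy => rw [smul_add]; exact P.add_mem hx hy
    | smul a x _ hx => rw [smul_comm]; exact P.smul_mem a hx
    | mem t ht =>
      rw [← Finset.mul_prod_erase T s ht, mul_comm, mul_smul]
      exact P.smul_mem _ (hsP t (hT t ht))

variable {A : Type u} [CommRing A] [IsDomain A] [IsLocalRing A]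

/-- A prime ideal of a two-dimensional local domain which is neither zero nor maximal. -/
structure IsCodimOne (q : Ideal A) : Prop where
  isPrime : q.IsPrime
  ne_bot : q ≠ ⊥
  ne_max : q ≠ maximalIdeal A

theorem height_maximalIdeal_eq_two (hdim : ringKrullDim A = 2) : (maximalIdeal A).height = 2 := by
  have := maximalIdeal_height_eq_ringKrullDim (R := A)
  rw [hdim] at this
  exact WithBot.coe_injective this

theorem IsCodimOne.lt_max {q : Ideal A} (hq : IsCodimOne q) : q < maximalIdeal A :=
  lt_of_le_of_ne (le_maximalIdeal hq.isPrime.ne_top) hq.ne_max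

theorem exists_isCodimOne (hdim : ringKrullDim A = 2) : ∃ q : Ideal A, IsCodimOne q := by
  by_contra! h
  have h1 : (maximalIdeal A).height ≤ (1 : ℕ) := by
    rw [Ideal.height_le_iff]
    intro p hp hlt
    have : p = ⊥ := by
      by_contra hp0
      exact h p ⟨hp, hp0, hlt.ne⟩
    simp [this]
  rw [height_maximalIdeal_eq_two hdim] at h1
  exact absurd h1 (by decide)

/-- A strict inclusion would give a chain `⊥ < p < q < 𝔪`, too long for dimension two. -/
theorem IsCodimOne.eq_of_le (hdim : ringKrullDim A = 2) {p q : Ideal A} (hp : p.IsPrime)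
    (hp0 : p ≠ ⊥) (hq : IsCodimOne q) (hpq : p ≤ q) : p = q := by
  by_contra hne
  have hq1 := hq.isPrime
  have h1 : (⊥ : Ideal A).height + 1 ≤ p.height :=
    Ideal.height_add_one_le_of_lt_of_isPrime (bot_lt_iff_ne_bot.2 hp0)
  have h2 : p.height + 1 ≤ q.height :=
    Ideal.height_add_one_le_of_lt_of_isPrime (lt_of_le_of_ne hpq hne)
  have h3 : q.height + 1 ≤ (maximalIdeal A).height :=
    Ideal.height_add_one_le_of_lt_of_isPrime hq.lt_max
  rw [height_maximalIdeal_eq_two hdim] at h3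
  have h4 : (0 + 1 + 1 + 1 : ℕ∞) ≤ 2 := by
    refine le_trans ?_ h3
    gcongr
    refine le_trans ?_ h2
    gcongr
    refine le_trans ?_ h1
    gcongr
    simp
  exact absurd h4 (by decide)

variable [IsNoetherianRing A]

/-- Only `𝔪` can be a prime above `I`, so `𝔪` lies in the radical. This is the passage from local
statements in codimension one to statements up to a power of `𝔪`; it is applied to ideals of
multipliers. -/
theorem exists_pow_le_of_forall_not_le (hdim : ringKrullDim A = 2) {I : Ideal A}
    (h : ∀ q, IsCodimOne q → ¬ I ≤ q) : ∃ n, maximalIdeal A ^ n ≤ I := by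
  refine Ideal.exists_pow_le_of_le_radical_of_fg ?_ (IsNoetherian.noetherian _)
  rw [Ideal.radical_eq_sInf, le_sInf_iff]
  rintro p ⟨hIp, hp⟩
  by_contra hp1
  have hpm : p ≠ maximalIdeal A := by rintro rfl; exact hp1 le_rfl
  by_cases hp0 : p = ⊥
  · obtain ⟨q, hq⟩ := exists_isCodimOne hdim
    exact h q hq (hIp.trans (hp0 ▸ bot_le))
  · exact h p ⟨hp, hp0, hpm⟩ hIp

/-- Such primes are minimal over `(b)`, because a smaller prime containing `b` is nonzero. -/
theorem finite_isCodimOne_mem (hdim : ringKrullDim A = 2) {b : A} (hb : b ≠ 0) :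
    {q : Ideal A | IsCodimOne q ∧ b ∈ q}.Finite := by
  refine (Ideal.finite_minimalPrimes_of_isNoetherianRing A (Ideal.span {b})).subset ?_
  rintro q ⟨hq, hbq⟩
  refine ⟨⟨hq.isPrime, by simpa [Ideal.span_le] using hbq⟩, ?_⟩
  rintro p ⟨hp, hbp⟩ hpq
  refine (hq.eq_of_le hdim hp ?_ hpq).ge
  rintro rfl
  exact hb (by simpa using hbp)

variable [IsIntegrallyClosed A]

/-- A nonzero prime of the localization contracts to a nonzero prime inside `q`, hence to `q`. So
the localization is normal with exactly one nonzero prime. -/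
theorem IsCodimOne.isDiscreteValuationRing (hdim : ringKrullDim A = 2) {q : Ideal A}
    (hq : IsCodimOne q) [q.IsPrime] : IsDiscreteValuationRing (Localization.AtPrime q) := by
  have hmax : maximalIdeal (Localization.AtPrime q) ≠ ⊥ := by
    intro h
    apply hq.ne_bot
    rw [← Localization.AtPrime.under_maximalIdeal (I := q), h, eq_bot_iff]
    intro x hx
    simpa using hx
  have hfield : ¬ IsField (Localization.AtPrime q) := isField_iff_maximalIdeal_eq.not.2 hmax
  have hic : IsIntegrallyClosed (Localization.AtPrime q) :=
    isIntegrallyClosed_of_isLocalization _ q.primeCompl q.primeCompl_le_nonZeroDivisors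
  have htfae : IsDiscreteValuationRing (Localization.AtPrime q) ↔
      IsIntegrallyClosed (Localization.AtPrime q) ∧
        ∃! P : Ideal (Localization.AtPrime q), P ≠ ⊥ ∧ P.IsPrime :=
    (IsDiscreteValuationRing.TFAE (Localization.AtPrime q) hfield).out 0 3
  refine htfae.2 ⟨hic, _, ⟨hmax, inferInstance⟩, ?_⟩
  rintro P ⟨hP0, hP⟩
  have h1 : P.under A = q := by
    refine hq.eq_of_le hdim inferInstance ?_ ?_
    · intro h
      apply hP0
      rw [← IsLocalization.map_under q.primeCompl (Localization.AtPrime q) P, h, Ideal.map_bot]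
    · exact (Ideal.comap_mono (le_maximalIdeal hP.ne_top)).trans
        Localization.AtPrime.under_maximalIdeal.le
  rw [← IsLocalization.map_under q.primeCompl (Localization.AtPrime q) P, h1,
    ← IsLocalization.map_under q.primeCompl (Localization.AtPrime q) (maximalIdeal _)]
  exact congrArg _ Localization.AtPrime.under_maximalIdeal.symm

/-- In the discrete valuation ring at `q` the ideal `J` becomes `(x)`. Not all of `J` can land in
`𝔪_q x`, and an element `g` of `J` outside it is a unit times `x`. The multiplier `s` is a common
denominator for the finitely many generators of `J`. -/
theorem exists_local_generator (hdim : ringKrullDim A = 2) {q : Ideal A} (hq : IsCodimOne q)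
    {J : Ideal A} (hJ : J ≠ ⊥) : ∃ g ∈ J, g ≠ 0 ∧ ∃ s ∉ q, ∀ j ∈ J, g ∣ s * j := by
  have := hq.isPrime
  have := hq.isDiscreteValuationRing hdim
  set B := Localization.AtPrime q
  obtain ⟨x, hx⟩ := (IsPrincipalIdealRing.principal (J.map (algebraMap A B))).principal
  have hinj : Function.Injective (algebraMap A B) :=
    IsLocalization.injective B q.primeCompl_le_nonZeroDivisors
  have hx0 : x ≠ 0 := by
    rintro rfl
    apply hJ
    rw [eq_bot_iff]
    intro j hj
    have : algebraMap A B j ∈ J.map (algebraMap A B) := Ideal.mem_map_of_mem _ hj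
    rw [hx] at this
    simpa [hinj.eq_iff' (map_zero _)] using this
  obtain ⟨g, hgJ, hg⟩ : ∃ g ∈ J, algebraMap A B g ∉ maximalIdeal B * Ideal.span {x} := by
    by_contra! h
    have h1 : J.map (algebraMap A B) ≤ maximalIdeal B * Ideal.span {x} := Ideal.map_le_iff_le_comap.2 h
    have h2 : x ∈ maximalIdeal B * Ideal.span {x} := h1 (hx ▸ Submodule.mem_span_singleton_self x)
    rw [mul_comm, Ideal.mem_span_singleton_mul] at h2
    obtain ⟨z, hz, hxz⟩ := h2
    have : z = 1 := mul_left_cancel₀ hx0 (by rw [hxz, mul_one])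
    exact (Ideal.ne_top_iff_one _).1 (maximalIdeal.isMaximal B).ne_top (this ▸ hz)
  have hgx : x ∣ algebraMap A B g := by
    have : algebraMap A B g ∈ J.map (algebraMap A B) := Ideal.mem_map_of_mem _ hgJ
    rw [hx] at this
    exact Ideal.mem_span_singleton.1 this
  obtain ⟨w, hw⟩ := hgx
  have hwu : IsUnit w := by
    by_contra hwu
    apply hg
    rw [hw, mul_comm x]
    exact Ideal.mul_mem_mul ((mem_maximalIdeal _).2 hwu) (Ideal.mem_span_singleton_self x)
  refine ⟨g, hgJ, ?_, ?_⟩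
  · rintro rfl
    apply hg; simp
  · have key := exists_notMem_smul_mem (q := q) hq.isPrime (N := J) (P := Ideal.span {g})
      (IsNoetherian.noetherian _) (fun j hj => by
        have h1 : algebraMap A B j ∈ J.map (algebraMap A B) := Ideal.mem_map_of_mem _ hj
        rw [hx] at h1
        obtain ⟨c, hc⟩ := Ideal.mem_span_singleton.1 h1
        have h2 : algebraMap A B g ∣ algebraMap A B j := by
          rw [hw, hc]
          exact mul_dvd_mul_left x (hwu.dvd)
        obtain ⟨d, hd⟩ := h2
        obtain ⟨⟨a, t⟩, hat⟩ := IsLocalization.surj q.primeCompl d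
        refine ⟨t, t.2, Ideal.mem_span_singleton.2 ⟨a, hinj ?_⟩⟩
        simp only [smul_eq_mul, map_mul]
        rw [hd, ← hat]; ring)
    obtain ⟨s, hs, h⟩ := key
    exact ⟨s, hs, fun j hj => Ideal.mem_span_singleton.1 (h j hj)⟩

theorem not_isPrincipal_maximalIdeal (hdim : ringKrullDim A = 2) (a : A) :
    maximalIdeal A ≠ Ideal.span {a} := by
  intro h
  have h1 := Ideal.height_le_one_of_isPrincipal_of_mem_minimalPrimes (Ideal.span {a})
    (maximalIdeal A) (by
      rw [← h]
      exact ⟨⟨inferInstance, le_rfl⟩, fun p hp _ => hp.2⟩)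
  rw [height_maximalIdeal_eq_two hdim] at h1
  exact absurd h1 (by decide)

/-- This is the depth-two property of a normal domain of dimension two: a fraction regular on the
punctured spectrum lies in `A`. Induction on `n` reduces to a fraction `w` with `𝔪 w ⊆ A`. -/
theorem mem_range_of_pow_smul_mem_range (hdim : ringKrullDim A = 2) (n : ℕ) (z : FractionRing A)
    (h : ∀ c ∈ maximalIdeal A ^ n, c • z ∈ (algebraMap A (FractionRing A)).range) :
    z ∈ (algebraMap A (FractionRing A)).range := by
  induction n generalizing z with
  | zero => simpa using h 1 (by simp)
  | succ n ih =>
    refine ih z fun c hc => ?_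
    generalize hw : c • z = w
    replace h : ∀ x ∈ maximalIdeal A, x • w ∈ (algebraMap A (FractionRing A)).range := by
      intro x hx
      rw [← hw, smul_smul]
      exact h _ (by rw [pow_succ']; exact Ideal.mul_mem_mul hx hc)
    have hm0 : maximalIdeal A ≠ ⊥ := by
      have := not_isPrincipal_maximalIdeal hdim (0 : A)
      simpa using this
    -- If `𝔪 w` contains a unit `a w`, then `𝔪 = (a)`, which is impossible in dimension two.
    -- Otherwise `𝔪 w ⊆ 𝔪`, so `w` is integral by the determinant trick.
    by_cases hu : ∃ a ∈ maximalIdeal A, ∃ v : A, IsUnit v ∧ a • w = algebraMap A (FractionRing A) v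
    · obtain ⟨a, ha, v, hv, hav⟩ := hu
      refine absurd (le_antisymm (fun x hx => ?_) ?_) (not_isPrincipal_maximalIdeal hdim a)
      · obtain ⟨y, hy⟩ := h x hx
        obtain ⟨v', rfl⟩ := hv
        refine Ideal.mem_span_singleton.2 ⟨y * ↑v'⁻¹, ?_⟩
        apply IsFractionRing.injective A (FractionRing A)
        have h1 : algebraMap A (FractionRing A) x * algebraMap A (FractionRing A) (v' : A) =
            algebraMap A (FractionRing A) a * algebraMap A (FractionRing A) y := by
          rw [hy, ← hav, Algebra.smul_def, Algebra.smul_def]; ring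
        rw [← map_mul, ← map_mul] at h1
        have h2 := IsFractionRing.injective A (FractionRing A) h1
        rw [← mul_assoc, ← h2, mul_assoc, Units.mul_inv, mul_one]
      · simpa [Ideal.span_le] using ha
    · have hmem : ∀ x ∈ maximalIdeal A, ∃ y ∈ maximalIdeal A,
          algebraMap A (FractionRing A) y = x • w := by
        intro x hx
        obtain ⟨y, hy⟩ := h x hx
        refine ⟨y, ?_, hy⟩
        rw [mem_maximalIdeal]
        intro hyu
        exact hu ⟨x, hx, y, hyu, hy.symm⟩
      have hint : IsIntegral A w := by
        refine isIntegral_of_smul_mem_submodule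
          (Submodule.map (Algebra.linearMap A (FractionRing A)) (maximalIdeal A)) ?_ ?_ w ?_
        · exact ((Submodule.map_injective_of_injective (IsFractionRing.injective A
            (FractionRing A))).ne_iff' (Submodule.map_bot _)).2 hm0
        · exact (IsNoetherian.noetherian (maximalIdeal A)).map _
        · rintro _ ⟨x, hx, rfl⟩
          obtain ⟨y, hy, hyx⟩ := hmem x hx
          refine ⟨y, hy, ?_⟩
          rw [Algebra.linearMap_apply, Algebra.linearMap_apply, hyx, Algebra.smul_def, smul_eq_mul,
            mul_comm]
      obtain ⟨a, ha⟩ := IsIntegrallyClosed.isIntegral_iff.1 hint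
      exact ⟨a, ha⟩

end CodimensionOne

/-! ### Filtrations of torsion-free modules by ideals. -/

section Flags

open IsLocalRing Function

theorem LinearMap.exists_comp_eq_of_surjective {A M N P : Type*} [CommRing A] [AddCommGroup M]
    [Module A M] [AddCommGroup N] [Module A N] [AddCommGroup P] [Module A P] (p : M →ₗ[A] N)
    (hp : Surjective p) (φ : M →ₗ[A] P) (h : ∀ x, p x = 0 → φ x = 0) :
    ∃ ψ : N →ₗ[A] P, ∀ x, ψ (p x) = φ x := by
  refine ⟨(LinearMap.ker p).liftQ φ (fun x hx => h x hx) ∘ₗ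
    (p.quotKerEquivOfSurjective hp).symm.toLinearMap, fun x => ?_⟩
  have : (p.quotKerEquivOfSurjective hp).symm (p x) = (LinearMap.ker p).mkQ x := by
    rw [LinearEquiv.symm_apply_eq]; rfl
  rw [LinearMap.comp_apply, LinearEquiv.coe_coe, this]
  exact Submodule.liftQ_apply _ _ _

theorem LinearMap.exists_comp_eq_of_injective {A M N P : Type*} [CommRing A] [AddCommGroup M]
    [Module A M] [AddCommGroup N] [Module A N] [AddCommGroup P] [Module A P] (i : N →ₗ[A] M)
    (hi : Injective i) (φ : P →ₗ[A] M) (h : ∀ x, φ x ∈ LinearMap.range i) :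
    ∃ ψ : P →ₗ[A] N, ∀ x, i (ψ x) = φ x := by
  refine ⟨(LinearEquiv.ofInjective i hi).symm.toLinearMap ∘ₗ φ.codRestrict _ h, fun x => ?_⟩
  have := LinearEquiv.apply_symm_apply (LinearEquiv.ofInjective i hi) ⟨φ x, h x⟩
  exact congrArg Subtype.val this

/-- A maximal independent subfamily of the generators spans a free module. Some `c ≠ 0` multiplies
all of `M` into it, and multiplication by `c` is injective. -/
theorem Module.exists_injective_pi_of_isTorsionFree (A M : Type*) [CommRing A] [IsDomain A]
    [AddCommGroup M] [Module A M] [Module.Finite A M] [Module.IsTorsionFree A M] :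
    ∃ (k : ℕ) (φ : M →ₗ[A] (Fin k → A)), Function.Injective φ := by
  classical
  obtain ⟨m, v, hv⟩ := Module.Finite.exists_fin (R := A) (M := M)
  obtain ⟨I, hI, hIs⟩ := exists_maximal_linearIndepOn A v
  have hex : ∀ i, ∃ a : A, a ≠ 0 ∧ a • v i ∈ Submodule.span A (v '' I) := by
    intro i
    by_cases hi : i ∈ I
    · exact ⟨1, one_ne_zero, by rw [one_smul]; exact Submodule.subset_span ⟨i, hi, rfl⟩⟩
    · exact hIs i hi
  choose a ha0 ha using hex
  set c := ∏ i, a i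
  have hc0 : c ≠ 0 := Finset.prod_ne_zero_iff.2 fun i _ => ha0 i
  have hc : ∀ x : M, c • x ∈ Submodule.span A (v '' I) := by
    intro x
    have hx : x ∈ Submodule.span A (Set.range v) := hv ▸ Submodule.mem_top
    induction hx using Submodule.span_induction with
    | zero => simp
    | add x y _ _ hx hy => rw [smul_add]; exact Submodule.add_mem _ hx hy
    | smul r x _ hx => rw [smul_comm]; exact Submodule.smul_mem _ r hx
    | mem x hx =>
      obtain ⟨i, rfl⟩ := hx
      change (∏ i, a i) • v i ∈ _
      rw [← Finset.mul_prod_erase _ _ (Finset.mem_univ i), mul_comm, mul_smul]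
      exact Submodule.smul_mem _ _ (ha i)
  have hr : Submodule.span A (v '' I) = Submodule.span A (Set.range fun i : I => v i) := by
    rw [Set.image_eq_range]
  rw [hr] at hc
  let b := Module.Basis.span (v := fun i : I => v i) hI
  let e : Fin (Fintype.card I) ≃ I := (Fintype.equivFin I).symm
  let h1 : M →ₗ[A] Submodule.span A (Set.range fun i : I => v i) :=
    (LinearMap.lsmul A M c).codRestrict _ hc
  refine ⟨Fintype.card I, (LinearMap.funLeft A A e) ∘ₗ b.equivFun.toLinearMap ∘ₗ h1, ?_⟩
  rw [LinearMap.coe_comp, LinearMap.coe_comp]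
  refine (LinearMap.funLeft_injective_of_surjective A A e e.surjective).comp
    (b.equivFun.injective.comp ?_)
  intro x y hxy
  have : c • x = c • y := congrArg Subtype.val hxy
  exact smul_right_injective M hc0 this

variable {A : Type u} [CommRing A]

/-- `M` has a finite filtration whose successive quotients are isomorphic to the nonzero ideals in
the list, starting from the bottom. -/
def HasFlag : List (Ideal A) → ∀ (M : Type u) [AddCommGroup M] [Module A M], Prop
  | [], M, _, _ => Subsingleton M
  | J :: l, M, _, _ => ∃ (N : Type u) (_ : AddCommGroup N) (_ : Module A N) (f : J →ₗ[A] M)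
      (g : M →ₗ[A] N), J ≠ ⊥ ∧ Injective f ∧ Surjective g ∧ Exact f g ∧ HasFlag l N

theorem HasFlag.congr {l : List (Ideal A)} {M N : Type u} [AddCommGroup M] [Module A M]
    [AddCommGroup N] [Module A N] (e : M ≃ₗ[A] N) (h : HasFlag l M) : HasFlag l N := by
  cases l with
  | nil => exact e.symm.toEquiv.subsingleton_congr.2 h
  | cons J l =>
    obtain ⟨P, _, _, f, g, hJ, hf, hg, hfg, hP⟩ := h
    refine ⟨P, _, _, e.toLinearMap ∘ₗ f, g ∘ₗ e.symm.toLinearMap, hJ, e.injective.comp hf,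
      hg.comp e.symm.surjective, fun y => ?_, hP⟩
    have := hfg (e.symm y)
    simp only [LinearMap.comp_apply, LinearEquiv.coe_coe]
    rw [this]
    constructor
    · rintro ⟨x, hx⟩; exact ⟨x, by simp [hx]⟩
    · rintro ⟨x, hx⟩; exact ⟨x, by simp [← hx]⟩

/-- Dividing `N` by the image of the bottom ideal of `M` leaves an extension of `P` by a module with
the shorter flag. -/
theorem HasFlag.append {l l' : List (Ideal A)} {M N P : Type u} [AddCommGroup M] [Module A M]
    [AddCommGroup N] [Module A N] [AddCommGroup P] [Module A P] (f : M →ₗ[A] N) (g : N →ₗ[A] P)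
    (hf : Injective f) (hg : Surjective g) (hfg : Exact f g) (hM : HasFlag l M)
    (hP : HasFlag l' P) : HasFlag (l ++ l') N := by
  induction l generalizing M N with
  | nil =>
    have : Subsingleton M := hM
    refine hP.congr (LinearEquiv.ofBijective g ⟨?_, hg⟩).symm
    rw [injective_iff_map_eq_zero]
    intro x hx
    obtain ⟨y, rfl⟩ := (hfg x).1 hx
    rw [Subsingleton.elim y 0, map_zero]
  | cons J l ih =>
    obtain ⟨M', _, _, i, p, hJ, hi, hp, hip, hM'⟩ := hM
    obtain ⟨f', hf'⟩ := p.exists_comp_eq_of_surjective hp ((LinearMap.range (f ∘ₗ i)).mkQ ∘ₗ f)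
      (fun x hx => by
        obtain ⟨j, rfl⟩ := (hip x).1 hx
        simp)
    refine ⟨N ⧸ LinearMap.range (f ∘ₗ i), _, _, f ∘ₗ i, (LinearMap.range (f ∘ₗ i)).mkQ, hJ,
      hf.comp hi, Submodule.mkQ_surjective _, ?_, ?_⟩
    · exact LinearMap.exact_iff.2 (by simp)
    · refine ih f' ((LinearMap.range (f ∘ₗ i)).liftQ g ?_) ?_ ?_ ?_ hM'
      · rintro _ ⟨j, rfl⟩
        exact hfg.apply_apply_eq_zero (i j)
      · rw [injective_iff_map_eq_zero]
        intro x hx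
        obtain ⟨x, rfl⟩ := hp x
        rw [hf'] at hx
        obtain ⟨j, hj⟩ := (Submodule.Quotient.mk_eq_zero _).1 hx
        rw [← hf hj]
        exact hip.apply_apply_eq_zero j
      · intro z
        obtain ⟨y, rfl⟩ := hg z
        exact ⟨Submodule.Quotient.mk y, rfl⟩
      · intro y
        obtain ⟨y, rfl⟩ := Submodule.Quotient.mk_surjective _ y
        rw [Submodule.liftQ_apply, hfg y]
        constructor
        · rintro ⟨x, rfl⟩; exact ⟨p x, hf' x⟩
        · rintro ⟨x, hx⟩
          obtain ⟨x, rfl⟩ := hp x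
          rw [hf'] at hx
          obtain ⟨j, hj⟩ := (Submodule.Quotient.eq _).1 hx
          exact ⟨x - i j, by rw [map_sub]; simp only [LinearMap.comp_apply] at hj; rw [hj]; abel⟩

theorem hasFlag_singleton {J : Ideal A} (hJ : J ≠ ⊥) : HasFlag [J] J := by
  refine ⟨PUnit, inferInstance, inferInstance, LinearMap.id, 0, hJ, fun _ _ h => h,
    fun y => ⟨0, Subsingleton.elim _ _⟩, fun y => ?_, inferInstanceAs (Subsingleton PUnit)⟩
  simp

/-- The first coordinate maps `M` onto an ideal and its kernel embeds in `A ^ k`. If that ideal is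
zero it must be omitted, and `M` itself embeds in `A ^ k`. -/
theorem exists_hasFlag_of_injective {k : ℕ} {M : Type u} [AddCommGroup M] [Module A M]
    (φ : M →ₗ[A] (Fin k → A)) (hφ : Injective φ) : ∃ l, HasFlag (A := A) l M := by
  induction k generalizing M with
  | zero => exact ⟨[], hφ.subsingleton⟩
  | succ k ih =>
    let g : M →ₗ[A] A := LinearMap.proj 0 ∘ₗ φ
    let t : M →ₗ[A] (Fin k → A) := LinearMap.funLeft A A Fin.succ ∘ₗ φ
    have ht : ∀ x, g x = 0 → t x = 0 → x = 0 := by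
      intro x h0 h1
      rw [injective_iff_map_eq_zero] at hφ
      refine hφ x (funext fun i => ?_)
      refine Fin.cases h0 (fun i => ?_) i
      exact congrFun h1 i
    obtain ⟨l, hl⟩ := ih (t ∘ₗ (LinearMap.ker g).subtype) (by
      rw [injective_iff_map_eq_zero]
      intro x hx
      exact Subtype.ext (ht x x.2 hx))
    by_cases hJ : LinearMap.range g = ⊥
    · refine ih t ?_
      rw [injective_iff_map_eq_zero]
      intro x hx
      refine ht x ?_ hx
      rw [LinearMap.range_eq_bot] at hJ
      rw [hJ]; rfl
    · refine ⟨l ++ [LinearMap.range g], HasFlag.append (LinearMap.ker g).subtype g.rangeRestrict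
        (Submodule.injective_subtype _) g.surjective_rangeRestrict ?_ hl (hasFlag_singleton hJ)⟩
      rw [LinearMap.exact_iff]
      simp

theorem exists_hasFlag [IsDomain A] (M : Type u) [AddCommGroup M] [Module A M] [Module.Finite A M]
    [Module.IsTorsionFree A M] : ∃ l, HasFlag (A := A) l M := by
  obtain ⟨k, φ, hφ⟩ := Module.exists_injective_pi_of_isTorsionFree A M
  exact exists_hasFlag_of_injective φ hφ

/-- Division by `g` as a linear map: `ν j = s * j / g`. -/
theorem exists_eq_mul_of_dvd [IsDomain A] {J : Ideal A} {g s : A} (hg0 : g ≠ 0)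
    (h : ∀ j ∈ J, g ∣ s * j) : ∃ ν : J →ₗ[A] A, ∀ j : J, s * j = g * ν j := by
  obtain ⟨ν, hν⟩ := (LinearMap.lsmul A A g).exists_comp_eq_of_injective
    (by intro x y hxy; exact mul_left_cancel₀ hg0 hxy) (LinearMap.lsmul A A s ∘ₗ J.subtype)
    (fun j => by
      obtain ⟨c, hc⟩ := h j j.2
      exact ⟨c, hc.symm⟩)
  exact ⟨ν, fun j => (hν j).symm⟩

variable [IsDomain A] [IsLocalRing A] [IsNoetherianRing A] [IsIntegrallyClosed A]

/-- Up to a multiplier outside `q`, a section over the quotient `N` lifts to `M` with an error in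
the bottom ideal `J`. At `q` that ideal has a single generator `a`, so one preimage `w` of `f a`
suffices to correct the error. -/
theorem HasFlag.exists_local_section (hdim : ringKrullDim A = 2) {q : Ideal A} (hq : IsCodimOne q)
    {l : List (Ideal A)} {M P : Type u} [AddCommGroup M] [Module A M] [AddCommGroup P] [Module A P]
    (hM : HasFlag l M) (π : P →ₗ[A] M) (hπ : Surjective π) :
    ∃ s ∉ q, ∃ σ : M →ₗ[A] P, ∀ x, π (σ x) = s • x := by
  induction l generalizing M with
  | nil =>
    have : Subsingleton M := hM
    exact ⟨1, hq.isPrime.one_notMem, 0, fun x => Subsingleton.elim _ _⟩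
  | cons J l ih =>
    obtain ⟨N, _, _, f, g, hJ, hf, hg, hfg, hN⟩ := hM
    obtain ⟨s, hs, σ, hσ⟩ := ih hN (g ∘ₗ π) (hg.comp hπ)
    obtain ⟨a, ha, ha0, s', hs', hdvd⟩ := exists_local_generator hdim hq hJ
    obtain ⟨ν, hν⟩ := exists_eq_mul_of_dvd ha0 hdvd
    obtain ⟨w, hw⟩ := hπ (f ⟨a, ha⟩)
    obtain ⟨μ, hμ⟩ := f.exists_comp_eq_of_injective hf (s • LinearMap.id - π ∘ₗ σ ∘ₗ g)
      (fun x => by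
        refine (hfg _).1 ?_
        have := hσ (g x)
        simp only [LinearMap.comp_apply] at this
        simp [this])
    refine ⟨s' * s, fun h => ?_, s' • (σ ∘ₗ g) + (LinearMap.toSpanSingleton A P w ∘ₗ ν) ∘ₗ μ,
      fun x => ?_⟩
    · exact (hq.isPrime.mem_or_mem h).elim hs' hs
    · have h1 : ν (μ x) • f ⟨a, ha⟩ = s' • f (μ x) := by
        rw [← map_smul, ← map_smul]
        congr 1
        ext
        simp only [Submodule.coe_smul, smul_eq_mul]
        rw [mul_comm, ← hν]
      simp only [LinearMap.add_apply, LinearMap.smul_apply, LinearMap.comp_apply, map_add, map_smul,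
        LinearMap.toSpanSingleton_apply, hw, h1, hμ]
      simp [mul_smul, smul_sub]

/-- A torsion-free module is projective on the punctured spectrum. -/
theorem exists_pow_section (hdim : ringKrullDim A = 2) {M P : Type u} [AddCommGroup M] [Module A M]
    [Module.Finite A M] [Module.IsTorsionFree A M] [AddCommGroup P] [Module A P]
    (π : P →ₗ[A] M) (hπ : Surjective π) :
    ∃ n, ∀ c ∈ maximalIdeal A ^ n, ∃ σ : M →ₗ[A] P, ∀ x, π (σ x) = c • x := by
  obtain ⟨l, hl⟩ := exists_hasFlag (A := A) M
  -- The scalars `c` for which `c • id` factors through `π` form an ideal, and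
  -- `HasFlag.exists_local_section` shows that no codimension-one prime contains it.
  let I : Ideal A :=
    { carrier := {c | ∃ σ : M →ₗ[A] P, ∀ x, π (σ x) = c • x}
      add_mem' := by
        rintro a b ⟨σ, hσ⟩ ⟨τ, hτ⟩
        exact ⟨σ + τ, fun x => by simp [hσ, hτ, add_smul]⟩
      zero_mem' := ⟨0, fun x => by simp⟩
      smul_mem' := by
        rintro a b ⟨σ, hσ⟩
        exact ⟨a • σ, fun x => by simp [hσ, mul_smul]⟩ }
  obtain ⟨n, hn⟩ := exists_pow_le_of_forall_not_le hdim (I := I) (fun q hq hle => by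
    obtain ⟨s, hs, σ, hσ⟩ := hl.exists_local_section hdim hq π hπ
    exact hs (hle ⟨σ, hσ⟩))
  exact ⟨n, fun c hc => hn hc⟩

end Flags

/-! ### Trading the two bottom ideals of a filtration. -/

section Switch

open IsLocalRing Function

/-- `I ⊆ J` after localizing at any prime of codimension one. -/
def CodimOneLE {A : Type u} [CommRing A] [IsLocalRing A] (I J : Ideal A) : Prop :=
  ∀ q : Ideal A, IsCodimOne q → ∃ s ∉ q, ∀ x ∈ I, s * x ∈ J

variable {A : Type u} [CommRing A] [IsDomain A] [IsLocalRing A]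

/-- Distinct codimension-one primes are incomparable, so a product of elements of the other primes
lying outside `q` works. Such `t` allow corrections at finitely many primes independently of each
other. -/
theorem exists_notMem_forall_mem (hdim : ringKrullDim A = 2) (Q : Finset (Ideal A))
    (hQ : ∀ q ∈ Q, IsCodimOne q) {q : Ideal A} (hq : IsCodimOne q) :
    ∃ t ∉ q, ∀ q' ∈ Q, q' ≠ q → t ∈ q' := by
  classical
  have hx : ∀ q', ∃ x, q' ∈ Q → q' ≠ q → x ∈ q' ∧ x ∉ q := by
    intro q'
    by_cases h : q' ∈ Q ∧ q' ≠ q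
    · have : ¬ q' ≤ q := fun hle =>
        h.2 (hq.eq_of_le hdim (hQ q' h.1).isPrime (hQ q' h.1).ne_bot hle)
      obtain ⟨x, hx, hx'⟩ := SetLike.not_le_iff_exists.1 this
      exact ⟨x, fun _ _ => ⟨hx, hx'⟩⟩
    · exact ⟨0, fun h1 h2 => absurd ⟨h1, h2⟩ h⟩
  choose x hx using hx
  refine ⟨∏ q' ∈ Q.erase q, x q', fun h => ?_, fun q' hq' hne => ?_⟩
  · have := hq.isPrime
    obtain ⟨q', hq', h'⟩ := (Ideal.IsPrime.prod_mem_iff).1 h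
    rw [Finset.mem_erase] at hq'
    exact (hx q' hq'.2 hq'.1).2 h'
  · exact Ideal.mem_of_dvd _ (Finset.dvd_prod_of_mem x (Finset.mem_erase.2 ⟨hne, hq'⟩))
      (hx q' hq' hne).1

variable [IsNoetherianRing A] [IsIntegrallyClosed A]

/-- At `q` the module `N` is free on `w` and `i g`, where `g` generates `J₁` and `p w` generates
`J₂` locally. The maps `l` and `m` are the two coordinate functions multiplied by a common
denominator `s`. -/
theorem exists_local_coordinates (hdim : ringKrullDim A = 2) {q : Ideal A} (hq : IsCodimOne q)
    {J₁ J₂ : Ideal A} (hJ₁ : J₁ ≠ ⊥) (hJ₂ : J₂ ≠ ⊥) {N : Type u} [AddCommGroup N] [Module A N]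
    (i : J₁ →ₗ[A] N) (p : N →ₗ[A] J₂) (hi : Injective i) (hp : Surjective p) (hip : Exact i p) :
    ∃ s ∉ q, ∃ (g : J₁) (w : N) (l m : N →ₗ[A] A), (∀ n, s • n = l n • w + m n • i g) ∧
      l w = s ∧ m w = 0 ∧ (∀ j, l (i j) = 0) ∧ (∀ j, s * j = m (i j) * g) ∧
      ∀ n, s * p n = l n * p w := by
  obtain ⟨c, hc, hc0, s, hs, hsc⟩ := exists_local_generator hdim hq hJ₂
  obtain ⟨g, hg, hg0, s', hs', hsg⟩ := exists_local_generator hdim hq hJ₁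
  obtain ⟨l, hl⟩ := exists_eq_mul_of_dvd hc0 hsc
  obtain ⟨ν, hν⟩ := exists_eq_mul_of_dvd hg0 hsg
  obtain ⟨w, hw⟩ := hp ⟨c, hc⟩
  have hwc : (p w : A) = c := by rw [hw]
  obtain ⟨μ, hμ⟩ := i.exists_comp_eq_of_injective hi
    (s • LinearMap.id - LinearMap.toSpanSingleton A N w ∘ₗ l ∘ₗ p) (fun n => by
      refine (hip _).1 ?_
      ext
      simp [hwc, hl, mul_comm])
  have hpi : ∀ j, p (i j) = 0 := hip.apply_apply_eq_zero
  have hlw : l (p w) = s := by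
    have := hl (p w)
    rw [hwc, mul_comm] at this
    exact (mul_left_cancel₀ hc0 this).symm
  have key : ∀ j, s' • (j : J₁) = ν j • ⟨g, hg⟩ := by
    intro j
    ext
    simp [hν, mul_comm]
  refine ⟨s' * s, fun h => (hq.isPrime.mem_or_mem h).elim hs' hs, ⟨g, hg⟩, w, s' • (l ∘ₗ p),
    ν ∘ₗ μ, fun n => ?_, ?_, ?_, ?_, ?_, ?_⟩
  · have h1 := hμ n
    simp only [LinearMap.sub_apply, LinearMap.smul_apply, LinearMap.id_apply, LinearMap.comp_apply,
      LinearMap.toSpanSingleton_apply] at h1 ⊢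
    rw [← map_smul i, ← key, map_smul, h1, smul_sub, smul_smul, smul_smul, smul_eq_mul]
    abel
  · simp [hlw]
  · have : μ w = 0 := hi (by rw [hμ]; simp [hlw])
    simp [this]
  · intro j; simp [hpi]
  · intro j
    have : μ (i j) = s • j := hi (by rw [hμ]; simp [hpi])
    simp only [LinearMap.comp_apply, this, map_smul, smul_eq_mul]
    rw [mul_assoc s, mul_comm (ν j), ← hν]; ring
  · intro n
    simp only [LinearMap.smul_apply, LinearMap.comp_apply, hwc, smul_eq_mul]
    rw [mul_assoc s', hl]; ring

/-- The aim is an `e` that is part of a local basis at every codimension-one prime. Where `p e` is a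
unit this is automatic; at the finitely many remaining primes it is enforced by making the
coordinate `m e` a unit. -/
theorem exists_basic_lift (hdim : ringKrullDim A = 2)
    {J₁ J₂ : Ideal A} (hJ₁ : J₁ ≠ ⊥) (hJ₂ : J₂ ≠ ⊥) {N : Type u} [AddCommGroup N] [Module A N]
    (i : J₁ →ₗ[A] N) (p : N →ₗ[A] J₂) (hi : Injective i) (hp : Surjective p) (hip : Exact i p) :
    ∃ e : N, (p e : A) ≠ 0 ∧ ∀ q, IsCodimOne q → (p e : A) ∈ q →
      ∃ s ∉ q, ∃ (g : J₁) (w : N) (l m : N →ₗ[A] A), (∀ n, s • n = l n • w + m n • i g) ∧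
      l w = s ∧ m w = 0 ∧ (∀ j, l (i j) = 0) ∧ (∀ j, s * j = m (i j) * g) ∧
      (∀ n, s * p n = l n * p w) ∧ m e ∉ q := by
  classical
  obtain ⟨b, hb, hb0⟩ := Submodule.exists_mem_ne_zero_of_ne_bot hJ₂
  obtain ⟨v, hv⟩ := hp ⟨b, hb⟩
  have hfin := finite_isCodimOne_mem hdim hb0
  set Q := hfin.toFinset
  have hQ : ∀ q, q ∈ Q ↔ IsCodimOne q ∧ b ∈ q := fun q => by simp [Q]
  have hloc : ∀ q : Q, ∃ s ∉ q.1, ∃ (g : J₁) (w : N) (l m : N →ₗ[A] A),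
      (∀ n, s • n = l n • w + m n • i g) ∧
      l w = s ∧ m w = 0 ∧ (∀ j, l (i j) = 0) ∧ (∀ j, s * j = m (i j) * g) ∧
      ∀ n, s * p n = l n * p w := fun q =>
    exists_local_coordinates hdim ((hQ q).1 q.2).1 hJ₁ hJ₂ i p hi hp hip
  choose s hs g w l m h1 h2 h3 h4 h5 h6 using hloc
  have ht : ∀ q : Q, ∃ t ∉ q.1, ∀ q' ∈ Q, q' ≠ q.1 → t ∈ q' := fun q =>
    exists_notMem_forall_mem hdim Q (fun q' hq' => ((hQ q').1 hq').1) ((hQ q).1 q.2).1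
  choose t ht ht' using ht
  have hmg : ∀ q, g q ≠ 0 → m q (i (g q)) = s q := by
    intro q hg0
    have := h5 q (g q)
    exact (mul_right_cancel₀ (fun h => hg0 (Subtype.ext h)) this).symm
  have hg0 : ∀ q, g q ≠ 0 := by
    intro q hg0
    obtain ⟨j, hj, hj0⟩ := Submodule.exists_mem_ne_zero_of_ne_bot hJ₁
    have := h5 q ⟨j, hj⟩
    rw [hg0] at this
    simp only [ZeroMemClass.coe_zero, mul_zero, mul_eq_zero] at this
    exact this.elim (fun h => hs q (h ▸ q.1.zero_mem)) hj0
  -- The lift `v` is corrected exactly at the primes `q` with `m q v ∈ q`. Modulo `q` the other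
  -- terms vanish, since their `t` lie in `q`, while the term at `q` adds `t q * s q ∉ q`.
  let a : J₁ := ∑ q : Q, if m q v ∈ q.1 then t q • g q else 0
  have hpe : (p (v + i a) : A) = b := by
    rw [map_add, hip.apply_apply_eq_zero, add_zero, hv]
  refine ⟨v + i a, by rw [hpe]; exact hb0, fun q hq hbq => ?_⟩
  rw [hpe] at hbq
  let q' : Q := ⟨q, (hQ q).2 ⟨hq, hbq⟩⟩
  refine ⟨s q', hs q', g q', w q', l q', m q', h1 q', h2 q', h3 q', h4 q', h5 q', h6 q', ?_⟩
  have hsum : m q' (i a) - (if m q' v ∈ q then t q' * s q' else 0) ∈ q := by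
    have : m q' (i a) = ∑ r : Q, if m r v ∈ r.1 then t r * m q' (i (g r)) else 0 := by
      simp only [a, map_sum]
      refine Finset.sum_congr rfl fun r _ => ?_
      split_ifs <;> simp
    rw [this, ← Finset.add_sum_erase _ _ (Finset.mem_univ q'), hmg q' (hg0 q'), add_sub_cancel_left]
    refine Ideal.sum_mem _ fun r hr => ?_
    split_ifs
    · refine Ideal.mul_mem_right _ _ (ht' r q q'.2 ?_)
      rintro h
      exact (Finset.mem_erase.1 hr).1 (Subtype.ext h.symm)
    · exact Ideal.zero_mem _
  rw [map_add]
  intro hmem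
  by_cases hvq : m q' v ∈ q
  · rw [if_pos hvq] at hsum
    have h7 : m q' (i a) ∈ q := (Ideal.add_mem_iff_right _ hvq).1 hmem
    have h8 : t q' * s q' ∈ q := by simpa using q.sub_mem h7 hsum
    exact (hq.isPrime.mem_or_mem h8).elim (ht q') (hs q')
  · rw [if_neg hvq, sub_zero] at hsum
    exact hvq ((Ideal.add_mem_iff_left _ hsum).1 hmem)

/-- A torsion-free module of rank two which is an extension of `J₂` by `J₁` is also an extension
of an ideal of class `[J₁ J₂]` by one of trivial class. -/
theorem exists_extension_of_extension (hdim : ringKrullDim A = 2)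
    {J₁ J₂ : Ideal A} (hJ₁ : J₁ ≠ ⊥) (hJ₂ : J₂ ≠ ⊥) {N : Type u} [AddCommGroup N] [Module A N]
    [Module.IsTorsionFree A N]
    (i : J₁ →ₗ[A] N) (p : N →ₗ[A] J₂) (hi : Injective i) (hp : Surjective p) (hip : Exact i p) :
    ∃ (I₁ I₂ : Ideal A) (i' : I₁ →ₗ[A] N) (p' : N →ₗ[A] I₂), I₂ ≠ ⊥ ∧ Injective i' ∧
      Surjective p' ∧ Exact i' p' ∧
      (∃ b, b ≠ 0 ∧ CodimOneLE I₁ (Ideal.span {b}) ∧ CodimOneLE (Ideal.span {b}) I₁) ∧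
      CodimOneLE I₂ (J₁ * J₂) ∧ CodimOneLE (J₁ * J₂) I₂ := by
  obtain ⟨e, he0, he⟩ := exists_basic_lift hdim hJ₁ hJ₂ i p hi hp hip
  have hpi : ∀ j, p (i j) = 0 := hip.apply_apply_eq_zero
  -- The map `n ↦ (p e) n - (p n) e` is the wedge product with `e`. It is killed by `p`, so it takes
  -- values in `J₁`; its kernel is the saturation of `A e` in `N`.
  obtain ⟨ψ, hψ⟩ := i.exists_comp_eq_of_injective hi
    ((p e : A) • LinearMap.id - LinearMap.toSpanSingleton A N e ∘ₗ J₂.subtype ∘ₗ p) (fun n => by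
      refine (hip _).1 ?_
      ext
      simp [mul_comm])
  replace hψ : ∀ n, i (ψ n) = (p e : A) • n - (p n : A) • e := by
    intro n; rw [hψ]; simp
  let ψA : N →ₗ[A] A := J₁.subtype ∘ₗ ψ
  have hker : ∀ n, ψA n = 0 ↔ (p e : A) • n = (p n : A) • e := by
    intro n
    rw [← sub_eq_zero (a := (p e : A) • n), ← hψ, map_eq_zero_iff i hi]
    exact ⟨fun h => Subtype.ext h, fun h => congrArg Subtype.val h⟩
  -- The map `p` is injective on the kernel, since `p n = 0` there forces `(p e) n = 0`. Its image
  -- is the ideal `I₁`, which contains `p e`; the image of `ψ` is `I₂`.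
  let φ : LinearMap.ker ψA →ₗ[A] A := J₂.subtype ∘ₗ p ∘ₗ (LinearMap.ker ψA).subtype
  have hφ : Injective φ := by
    rw [injective_iff_map_eq_zero]
    rintro ⟨n, hn⟩ h0
    have h1 : (p n : A) = 0 := h0
    have h2 := (hker n).1 hn
    rw [h1, zero_smul] at h2
    exact Subtype.ext ((smul_eq_zero.1 h2).resolve_left he0)
  let ε := LinearEquiv.ofInjective φ hφ
  have heker : ψA e = 0 := (hker e).2 rfl
  have hbI₁ : (p e : A) ∈ LinearMap.range φ := ⟨⟨e, heker⟩, rfl⟩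
  have hψi : ∀ j : J₁, (p e : A) * j ∈ LinearMap.range ψA := by
    intro j
    refine ⟨i j, ?_⟩
    have : ψ (i j) = (p e : A) • j := hi (by rw [hψ, hpi]; simp)
    simp [ψA, this]
  refine ⟨LinearMap.range φ, LinearMap.range ψA, (LinearMap.ker ψA).subtype ∘ₗ ε.symm.toLinearMap,
    ψA.rangeRestrict, ?_, (Submodule.injective_subtype _).comp ε.symm.injective,
    ψA.surjective_rangeRestrict, ?_, ⟨p e, he0, ?_, ?_⟩, ?_, ?_⟩
  · obtain ⟨j, hj, hj0⟩ := Submodule.exists_mem_ne_zero_of_ne_bot hJ₁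
    intro h
    have := hψi ⟨j, hj⟩
    rw [h] at this
    exact mul_ne_zero he0 hj0 this
  · rw [LinearMap.exact_iff, LinearMap.range_comp_of_range_eq_top _ (LinearEquiv.range _)]
    simp
  · intro q hq
    by_cases hb : (p e : A) ∈ q
    · obtain ⟨s, hs, g, w, l, m, h1, h2, h3, h4, h5, h6, h7⟩ := he q hq hb
      refine ⟨m e, h7, ?_⟩
      rintro _ ⟨⟨n, hn⟩, rfl⟩
      -- The `m`-coordinates give `(p e) (m n) = (p n) (m e)`, so `m e ∉ q` multiplies `p n` into
      -- `(p e)`.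
      have := congrArg m ((hker n).1 hn)
      rw [map_smul, map_smul] at this
      refine Ideal.mem_span_singleton.2 ⟨m n, ?_⟩
      rw [mul_comm]
      exact this.symm
    · exact ⟨p e, hb, fun x _ => Ideal.mem_span_singleton.2 (dvd_mul_right _ _)⟩
  · intro q hq
    refine ⟨1, hq.isPrime.one_notMem, fun x hx => ?_⟩
    rw [one_mul]
    exact (Ideal.span_singleton_le_iff_mem _).2 hbI₁ hx
  · intro q hq
    by_cases hb : (p e : A) ∈ q
    · obtain ⟨s, hs, g, w, l, m, h1, h2, h3, h4, h5, h6, h7⟩ := he q hq hb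
      refine ⟨s * s, fun h => (hq.isPrime.mem_or_mem h).elim hs hs, ?_⟩
      rintro _ ⟨n, rfl⟩
      -- In local coordinates `ψ n` is the determinant of `e` and `n`, times `p w` and `g`.
      have h8 : (s * s) • i (ψ n) = i (((p w : A) * (l e * m n - l n * m e)) • g) := by
        rw [hψ, map_smul]
        have e1 : (s * s) • ((p e : A) • n - (p n : A) • e) =
            (s * p e : A) • (s • n) - (s * p n : A) • (s • e) := by
          simp only [smul_sub, smul_smul]; congr 2 <;> ring
        rw [e1, h1 n, h1 e, h6 e, h6 n]
        simp only [smul_add, smul_smul, mul_sub, sub_smul]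
        have e2 : l e * (p w : A) * l n = l n * (p w : A) * l e := by ring
        have e3 : l e * (p w : A) * m n = (p w : A) * (l e * m n) := by ring
        have e4 : l n * (p w : A) * m e = (p w : A) * (l n * m e) := by ring
        rw [e2, e3, e4]; abel
      rw [← map_smul] at h8
      have h9 := congrArg Subtype.val (hi h8)
      change s * s * (ψ n : A) ∈ _
      have h10 : s * s * (ψ n : A) = (p w : A) * (l e * m n - l n * m e) * (g : A) := h9
      rw [h10, mul_comm (p w : A), mul_assoc, mul_comm (p w : A)]
      exact Ideal.mul_mem_left _ _ (Ideal.mul_mem_mul g.2 (p w).2)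
    · refine ⟨p e, hb, ?_⟩
      rintro _ ⟨n, rfl⟩
      change (p e : A) * (ψ n : A) ∈ _
      rw [mul_comm (p e : A)]
      exact Ideal.mul_mem_mul (ψ n).2 (p e).2
  · intro q hq
    by_cases hb : (p e : A) ∈ q
    · obtain ⟨s, hs, g, w, l, m, h1, h2, h3, h4, h5, h6, h7⟩ := he q hq hb
      have hs0 : s ≠ 0 := fun h => hs (h ▸ q.zero_mem)
      -- For `n = w` the determinant reduces to `-s * m e`. As `m e` and `s` are units at `q`, the
      -- image of `ψ` contains the local generator `g * p w` of `J₁ J₂` up to a unit.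
      have h8 : s • i (ψ w) = i ((-((p w : A) * m e)) • g) := by
        rw [hψ, map_smul, smul_sub, smul_comm s (p w : A) e, h1 e, smul_smul, h6 e, smul_add,
          smul_smul, smul_smul, mul_comm (l e), neg_smul]
        abel
      rw [← map_smul] at h8
      have h9 : s * (ψ w : A) = -((p w : A) * m e) * g := congrArg Subtype.val (hi h8)
      have hmem : (g : A) * p w * m e ∈ LinearMap.range ψA := by
        have : (g : A) * p w * m e = (-s) • ψA w := by
          change _ = -s * (ψ w : A)
          rw [neg_mul, h9]; ring
        rw [this]
        exact Submodule.smul_mem _ _ ⟨w, rfl⟩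
      refine ⟨s * s * m e, fun h => ?_, fun x hx => ?_⟩
      · exact (hq.isPrime.mem_or_mem h).elim
          (fun h => (hq.isPrime.mem_or_mem h).elim hs hs) h7
      · refine Submodule.mul_induction_on (C := fun x => s * s * m e * x ∈ LinearMap.range ψA) hx
          (fun j hj k hk => ?_) (fun x y hx hy => ?_)
        · obtain ⟨n, hn⟩ := hp ⟨k, hk⟩
          have h10 := h6 n
          rw [hn] at h10
          have h11 : s * j = m (i ⟨j, hj⟩) * g := h5 ⟨j, hj⟩
          have : s * s * m e * (j * k) = (m (i ⟨j, hj⟩) * l n) * ((g : A) * p w * m e) := by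
            calc s * s * m e * (j * k) = (s * j) * (s * k) * m e := by ring
              _ = _ := by rw [h11, h10]; ring
          rw [this]
          exact Ideal.mul_mem_left _ _ hmem
        · rw [mul_add]; exact Submodule.add_mem _ hx hy
    · refine ⟨p e, hb, fun x hx => ?_⟩
      refine Submodule.mul_induction_on (C := fun x => (p e : A) * x ∈ LinearMap.range ψA) hx
          (fun j hj k hk => ?_) (fun x y hx hy => ?_)
      · rw [← mul_assoc]
        exact Ideal.mul_mem_right _ _ (hψi ⟨j, hj⟩)
      · rw [mul_add]; exact Submodule.add_mem _ hx hy

end Switch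

/-! ### Modules extended along a completion-like homomorphism. -/

section Extended

open IsLocalRing Function TensorProduct

/-- A homomorphism of local rings which induces surjections `R / 𝔪 ^ n → S / 𝔪 ^ n S`, where
`𝔪 S` is the maximal ideal of `S`. The completion of a Noetherian local ring is an example. -/
class IsCompletionLike (R S : Type*) [CommRing R] [IsLocalRing R] [CommRing S] [IsLocalRing S]
    [Algebra R S] : Prop where
  map_maximalIdeal : (maximalIdeal R).map (algebraMap R S) = maximalIdeal S
  exists_sub_mem : ∀ s : S, ∃ r : R, s - algebraMap R S r ∈ maximalIdeal S

variable (R : Type u) {S : Type u} [CommRing R] [CommRing S] [Algebra R S]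

/-- An `S`-module is extended if it is the base change of a finitely generated `R`-module. -/
def IsExtended (N : Type u) [AddCommGroup N] [Module S N] : Prop :=
  ∃ (N₀ : Type u) (_ : AddCommGroup N₀) (_ : Module R N₀), Module.Finite R N₀ ∧
    Nonempty (N ≃ₗ[S] S ⊗[R] N₀)

theorem IsExtended.congr {R : Type u} {S : Type u} [CommRing R] [CommRing S] [Algebra R S]
    {N N' : Type u} [AddCommGroup N] [Module S N] [AddCommGroup N'] [Module S N'] (e : N ≃ₗ[S] N')
    (h : IsExtended R (S := S) N) : IsExtended R (S := S) N' := by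
  obtain ⟨N₀, _, _, hfin, ⟨e'⟩⟩ := h
  exact ⟨N₀, _, _, hfin, ⟨e.symm ≪≫ₗ e'⟩⟩

variable [IsLocalRing R] [IsLocalRing S] [IsCompletionLike R S]

namespace IsCompletionLike

variable (S) in
theorem isLocalHom : IsLocalHom (algebraMap R S) :=
  ((IsLocalRing.local_hom_TFAE (algebraMap R S)).out 0 2).2 (map_maximalIdeal (R := R) (S := S)).le

variable (S) in
theorem faithfullyFlat [Module.Flat R S] : Module.FaithfullyFlat R S :=
  have := isLocalHom R S
  Module.FaithfullyFlat.of_flat_of_isLocalHom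

variable (S) in
theorem map_pow_maximalIdeal (n : ℕ) :
    (maximalIdeal R ^ n).map (algebraMap R S) = maximalIdeal S ^ n := by
  rw [Ideal.map_pow, map_maximalIdeal]

/-- Successive approximation: an element of `𝔪_S ^ n` is an `S`-combination of elements of `𝔪_R ^
n`, and replacing its coefficients by elements of `R` modulo `𝔪_S` gains one power. -/
theorem exists_sub_mem_pow (n : ℕ) (s : S) : ∃ r : R, s - algebraMap R S r ∈ maximalIdeal S ^ n := by
  have key : ∀ n : ℕ, ∀ x ∈ maximalIdeal S ^ n, ∃ r : R, x - algebraMap R S r ∈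
      maximalIdeal S ^ (n + 1) := by
    intro n x hx
    rw [← map_pow_maximalIdeal R] at hx
    refine Submodule.closure_induction
      (p := fun x _ => ∃ r : R, x - algebraMap R S r ∈ maximalIdeal S ^ (n + 1))
      ⟨0, by simp⟩ ?_ ?_ hx
    · rintro x y _ _ ⟨r, hr⟩ ⟨t, ht⟩
      refine ⟨r + t, ?_⟩
      have : x + y - algebraMap R S (r + t) = (x - algebraMap R S r) + (y - algebraMap R S t) := by
        rw [map_add]; ring
      rw [this]; exact add_mem hr ht
    · rintro a _ ⟨c, hc, rfl⟩
      obtain ⟨b, hb⟩ := exists_sub_mem (R := R) a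
      refine ⟨b * c, ?_⟩
      have : a • algebraMap R S c - algebraMap R S (b * c) =
          (a - algebraMap R S b) * algebraMap R S c := by
        rw [map_mul, smul_eq_mul]; ring
      rw [this, pow_succ']
      exact Ideal.mul_mem_mul hb (by rw [← map_pow_maximalIdeal R]; exact Ideal.mem_map_of_mem _ hc)
  induction n with
  | zero => exact ⟨0, by simp⟩
  | succ n ih =>
    obtain ⟨r, hr⟩ := ih
    obtain ⟨t, ht⟩ := key n _ hr
    exact ⟨r + t, by rwa [map_add, ← sub_sub]⟩

theorem exists_sub_tmul_mem (n : ℕ) {M : Type*} [AddCommGroup M] [Module R M] (x : S ⊗[R] M) :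
    ∃ y : M, x - (1 : S) ⊗ₜ[R] y ∈ maximalIdeal S ^ n • (⊤ : Submodule S (S ⊗[R] M)) := by
  induction x with
  | zero => exact ⟨0, by simp⟩
  | tmul s m =>
    obtain ⟨r, hr⟩ := exists_sub_mem_pow R n s
    refine ⟨r • m, ?_⟩
    have : s ⊗ₜ[R] m - (1 : S) ⊗ₜ[R] (r • m) = (s - algebraMap R S r) • ((1 : S) ⊗ₜ[R] m) := by
      refine Eq.symm ((_root_.sub_smul s (algebraMap R S r) ((1 : S) ⊗ₜ[R] m)).trans ?_)
      rw [smul_tmul', smul_eq_mul, mul_one, algebraMap_smul, tmul_smul]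
    rw [this]
    exact Submodule.smul_mem_smul hr Submodule.mem_top
  | add x y hx hy =>
    obtain ⟨a, ha⟩ := hx
    obtain ⟨b, hb⟩ := hy
    refine ⟨a + b, ?_⟩
    rw [tmul_add, add_sub_add_comm]
    exact add_mem ha hb

end IsCompletionLike

open IsCompletionLike

/-- The module `N` is the base change of its preimage `N₁` in `N₀`. Elements `1 ⊗ x` are dense, so
`N` is generated by `𝔪 ^ n (S ⊗ N₀)` and the elements `1 ⊗ x` inside it, and both come from `N₁`. -/
theorem isExtended_of_pow_smul_le [IsNoetherianRing R] [Module.Flat R S] {N₀ : Type u}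
    [AddCommGroup N₀] [Module R N₀]
    [Module.Finite R N₀] (N : Submodule S (S ⊗[R] N₀)) (n : ℕ)
    (h : maximalIdeal S ^ n • (⊤ : Submodule S (S ⊗[R] N₀)) ≤ N) :
    IsExtended R (S := S) N := by
  let N₁ : Submodule R N₀ := (N.restrictScalars R).comap (TensorProduct.mk R S N₀ 1)
  let f : S ⊗[R] N₁ →ₗ[S] S ⊗[R] N₀ := N₁.subtype.baseChange S
  have hf : Injective f :=
    Module.Flat.lTensor_preserves_injective_linearMap N₁.subtype N₁.injective_subtype
  have hpow : maximalIdeal S ^ n • (⊤ : Submodule S (S ⊗[R] N₀)) ≤ LinearMap.range f := by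
    rw [Submodule.smul_le]
    intro c hc y _
    rw [← map_pow_maximalIdeal R] at hc
    induction hc using Submodule.closure_induction with
    | zero => simp
    | add a b _ _ ha hb => rw [add_smul]; exact add_mem ha hb
    | smul_mem a c hc =>
      obtain ⟨c, hc, rfl⟩ := hc
      rw [smul_assoc]
      refine Submodule.smul_mem _ _ ?_
      induction y with
      | zero => simp
      | add x y hx hy =>
        rw [smul_add]; exact add_mem (hx trivial) (hy trivial)
      | tmul s m =>
        have hm : c • m ∈ N₁ := by
          change (1 : S) ⊗ₜ[R] (c • m) ∈ N
          rw [tmul_smul, ← algebraMap_smul S c]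
          exact h (Submodule.smul_mem_smul
            (by rw [← map_pow_maximalIdeal R]; exact Ideal.mem_map_of_mem _ hc) trivial)
        refine ⟨s ⊗ₜ ⟨c • m, hm⟩, ?_⟩
        simp [f, algebraMap_smul]
  have hrange : LinearMap.range f = N := by
    apply le_antisymm
    · rintro _ ⟨x, rfl⟩
      induction x with
      | zero => simp
      | add x y hx hy => rw [map_add]; exact add_mem hx hy
      | tmul s m =>
        have hm : (1 : S) ⊗ₜ[R] (m : N₀) ∈ N := m.2
        have : f (s ⊗ₜ m) = s • ((1 : S) ⊗ₜ[R] (m : N₀)) := by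
          simp [f, smul_tmul']
        rw [this]
        exact N.smul_mem s hm
    · intro y hy
      obtain ⟨x, hx⟩ := exists_sub_tmul_mem R n y
      have hxN : (1 : S) ⊗ₜ[R] x ∈ N := by
        have := N.sub_mem hy (h hx)
        simpa using this
      have h1 : (1 : S) ⊗ₜ[R] x ∈ LinearMap.range f := ⟨1 ⊗ₜ ⟨x, hxN⟩, by simp [f]⟩
      have := add_mem (hpow hx) h1
      simpa using this
  exact ⟨N₁, _, _, inferInstance,
    ⟨(LinearEquiv.ofEq _ _ hrange.symm) ≪≫ₗ (LinearEquiv.ofInjective f hf).symm⟩⟩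

/-- When `K` is the kernel of a map from a free module `P` onto `B`, maps out of `K` modulo those
extending to `P` compute `Ext¹(B, M)`. The hypothesis says that `𝔪 ^ n` kills this quotient, so in
`Hom_S(S ⊗ K, S ⊗ M) = S ⊗ Hom_R(K, M)` the coefficients from `S` may be replaced by approximations
from `R`. -/
theorem exists_eq_baseChange_add_comp [IsNoetherianRing R] [Module.Flat R S] {K P M : Type u}
    [AddCommGroup K] [Module R K]
    [AddCommGroup P] [Module R P] [AddCommGroup M] [Module R M] [Module.Finite R K]
    (ι : K →ₗ[R] P) (n : ℕ)
    (hι : ∀ c ∈ maximalIdeal R ^ n, ∃ ρ : P →ₗ[R] K, ∀ x, ρ (ι x) = c • x)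
    (φ : S ⊗[R] K →ₗ[S] S ⊗[R] M) :
    ∃ (φ₀ : K →ₗ[R] M) (ψ : S ⊗[R] P →ₗ[S] S ⊗[R] M),
      φ = φ₀.baseChange S + ψ ∘ₗ ι.baseChange S := by
  have : Module.FinitePresentation R K := Module.finitePresentation_of_finite R K
  refine (Module.FinitePresentation.isBaseChange_map R K M S).inductionOn φ
    (fun φ => ∃ (φ₀ : K →ₗ[R] M) (ψ : S ⊗[R] P →ₗ[S] S ⊗[R] M),
      φ = φ₀.baseChange S + ψ ∘ₗ ι.baseChange S) ?_ ?_ ?_ ?_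
  · exact ⟨0, 0, by simp⟩
  · intro φ₀
    exact ⟨φ₀, 0, by simp⟩
  · rintro s _ ⟨φ₀, ψ, rfl⟩
    have key : ∀ t ∈ maximalIdeal S ^ n, ∃ ψ' : S ⊗[R] P →ₗ[S] S ⊗[R] M,
        t • φ₀.baseChange S = ψ' ∘ₗ ι.baseChange S := by
      intro t ht
      rw [← map_pow_maximalIdeal R] at ht
      induction ht using Submodule.closure_induction with
      | zero => exact ⟨0, by simp⟩
      | add a b _ _ ha hb =>
        obtain ⟨ψ₁, h₁⟩ := ha
        obtain ⟨ψ₂, h₂⟩ := hb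
        exact ⟨ψ₁ + ψ₂, by rw [add_smul, h₁, h₂, LinearMap.add_comp]⟩
      | smul_mem a c hc =>
        obtain ⟨c, hc, rfl⟩ := hc
        obtain ⟨ρ, hρ⟩ := hι c hc
        refine ⟨a • (φ₀ ∘ₗ ρ).baseChange S, ?_⟩
        rw [smul_assoc, LinearMap.smul_comp, ← LinearMap.baseChange_comp]
        congr 1
        refine LinearMap.ext fun x => ?_
        induction x with
        | zero => simp
        | add x y hx hy => rw [map_add, map_add, hx, hy]
        | tmul s x =>
          rw [LinearMap.smul_apply, LinearMap.baseChange_tmul, LinearMap.baseChange_tmul,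
            LinearMap.comp_apply, LinearMap.comp_apply, hρ, map_smul, tmul_smul, algebraMap_smul]
    obtain ⟨r, hr⟩ := exists_sub_mem_pow R n s
    obtain ⟨ψ', hψ'⟩ := key _ hr
    refine ⟨r • φ₀, s • ψ + ψ', ?_⟩
    rw [LinearMap.add_comp, ← hψ', show (s - algebraMap R S r) • φ₀.baseChange S =
      s • φ₀.baseChange S - algebraMap R S r • φ₀.baseChange S from
        _root_.sub_smul s (algebraMap R S r) (φ₀.baseChange S), smul_add, LinearMap.smul_comp]
    have : (r • φ₀).baseChange S = algebraMap R S r • φ₀.baseChange S := by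
      rw [LinearMap.baseChange_smul, algebraMap_smul]
    rw [this]; abel
  · rintro _ _ ⟨φ₁, ψ₁, rfl⟩ ⟨φ₂, ψ₂, rfl⟩
    refine ⟨φ₁ + φ₂, ψ₁ + ψ₂, ?_⟩
    rw [LinearMap.baseChange_add, LinearMap.add_comp]; abel

variable [IsNoetherianRing R] [IsDomain R] [IsIntegrallyClosed R] [Module.Flat R S] [IsDomain S]

/-- The extension is described by a map `φ` from the base change of the kernel of a presentation of
`B₀` to that of `A₀`. Up to changing a lift, `φ` is defined over `R`, and the corresponding pushout
over `R` has base change `N`. -/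
theorem IsExtended.of_extension (hdim : ringKrullDim R = 2) {M N P : Type u} [AddCommGroup M]
    [Module S M] [AddCommGroup N] [Module S N] [AddCommGroup P] [Module S P]
    [Module.IsTorsionFree S P] (f : M →ₗ[S] N) (g : N →ₗ[S] P) (hf : Injective f)
    (hg : Surjective g) (hfg : Exact f g) (hM : IsExtended R (S := S) M)
    (hP : IsExtended R (S := S) P) : IsExtended R (S := S) N := by
  obtain ⟨A₀, _, _, hA, ⟨eA⟩⟩ := hM
  obtain ⟨B₀, _, _, hB, ⟨eB⟩⟩ := hP
  have := faithfullyFlat R S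
  have hinj := FaithfulSMul.algebraMap_injective R S
  -- Torsion-freeness descends along the injection `B₀ → S ⊗ B₀`; it is what `exists_pow_section`
  -- requires.
  have hBtf : Module.IsTorsionFree R B₀ := by
    rw [Module.isTorsionFree_iff_smul_eq_zero]
    intro r b hrb
    by_cases hr : r = 0
    · exact Or.inl hr
    right
    have h1 : algebraMap R S r • eB.symm ((1 : S) ⊗ₜ[R] b) = 0 := by
      rw [← map_smul, algebraMap_smul, ← tmul_smul, hrb, tmul_zero, map_zero]
    have h2 := (smul_eq_zero.1 h1).resolve_left (by simpa [hinj.eq_iff' (map_zero _)] using hr)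
    rw [LinearEquiv.map_eq_zero_iff] at h2
    exact Module.FaithfullyFlat.tensorProduct_mk_injective (A := R) (B := S) B₀
      (h2.trans (tmul_zero _ _).symm)
  obtain ⟨k, π, hπ⟩ := Module.Finite.exists_fin' R B₀
  let ι := (LinearMap.ker π).subtype
  obtain ⟨f, hf, hfeq⟩ : ∃ f' : S ⊗[R] A₀ →ₗ[S] N, Injective f' ∧
      LinearMap.range f' = LinearMap.range f :=
    ⟨f ∘ₗ eA.symm.toLinearMap, hf.comp eA.symm.injective,
      LinearMap.range_comp_of_range_eq_top _ (LinearEquiv.range _)⟩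
  obtain ⟨g, hg, hgeq⟩ : ∃ g' : N →ₗ[S] S ⊗[R] B₀, Surjective g' ∧
      LinearMap.ker g' = LinearMap.ker g :=
    ⟨eB.toLinearMap ∘ₗ g, eB.surjective.comp hg,
      LinearMap.ker_comp_of_ker_eq_bot _ (LinearEquiv.ker _)⟩
  replace hfg : Exact f g := by
    rw [LinearMap.exact_iff] at hfg ⊢
    rw [hgeq, hfg, hfeq]
  obtain ⟨n, hn⟩ := exists_pow_section hdim π hπ
  obtain ⟨h, hh⟩ := Module.projective_lifting_property g (π.baseChange S) hg
  replace hh : ∀ x, g (h x) = π.baseChange S x := fun x => LinearMap.congr_fun hh x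
  have hexK : Exact (ι.baseChange S) (π.baseChange S) :=
    lTensor_exact S (f := ι) (g := π) (by rw [LinearMap.exact_iff]; simp [ι]) hπ
  obtain ⟨φ, hφ⟩ := f.exists_comp_eq_of_injective hf (h ∘ₗ ι.baseChange S) (fun x =>
    (hfg _).1 (by rw [LinearMap.comp_apply, hh]; exact hexK.apply_apply_eq_zero x))
  obtain ⟨φ₀, ψ, rfl⟩ := exists_eq_baseChange_add_comp R ι n (fun c hc => by
    obtain ⟨σ, hσ⟩ := hn c hc
    -- As `π σ = c`, the map `c - σ π` takes values in `ker π`, on which it is multiplication by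
    -- `c`.
    obtain ⟨ρ, hρ⟩ := ι.exists_comp_eq_of_injective (LinearMap.ker π).injective_subtype
      (c • LinearMap.id - σ ∘ₗ π) (fun x => by
        simp only [ι, Submodule.range_subtype, LinearMap.mem_ker]
        simp [hσ])
    refine ⟨ρ, fun x => (LinearMap.ker π).injective_subtype ?_⟩
    have hx : π x = 0 := x.2
    have := hρ (ι x)
    simp only [LinearMap.sub_apply, LinearMap.smul_apply, LinearMap.id_apply,
      LinearMap.comp_apply] at this
    change ι _ = _
    rw [this]
    simp [ι, hx]) φ
  -- Subtracting `f ψ` from the lift `h` replaces `φ` by the base change of `φ₀`.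
  let h' : S ⊗[R] (Fin k → R) →ₗ[S] N := h - f ∘ₗ ψ
  have hgf : ∀ x, g (f x) = 0 := hfg.apply_apply_eq_zero
  have hh' : ∀ x, g (h' x) = π.baseChange S x := by
    intro x; simp [h', hh, hgf]
  have hφ' : ∀ x, f (φ₀.baseChange S x) = h' (ι.baseChange S x) := by
    intro x
    have := hφ x
    simp only [LinearMap.add_apply, map_add, LinearMap.comp_apply] at this
    simp [h', ← this]
  -- The cokernel of `κ` is the pushout of `φ₀` and `ι`. The map `Θ` below identifies its base
  -- change with `N`.
  let κ : LinearMap.ker π →ₗ[R] A₀ × (Fin k → R) := LinearMap.prod φ₀ (-ι)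
  let F := (LinearMap.fst R A₀ (Fin k → R)).baseChange S
  let G := (LinearMap.snd R A₀ (Fin k → R)).baseChange S
  let F' := (LinearMap.inl R A₀ (Fin k → R)).baseChange S
  let G' := (LinearMap.inr R A₀ (Fin k → R)).baseChange S
  have hid : ∀ z, z = F' (F z) + G' (G z) := by
    intro z
    have h1 : F' ∘ₗ F + G' ∘ₗ G = LinearMap.id := by
      rw [← LinearMap.baseChange_comp, ← LinearMap.baseChange_comp, ← LinearMap.baseChange_add,
        ← LinearMap.baseChange_id]
      congr 1
      ext <;> simp
    exact (LinearMap.congr_fun h1 z).symm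
  have hFF' : ∀ x, F (F' x) = x := by
    intro x
    have : F ∘ₗ F' = LinearMap.id := by
      rw [← LinearMap.baseChange_comp, LinearMap.fst_comp_inl, LinearMap.baseChange_id]
    exact LinearMap.congr_fun this x
  have hGF' : ∀ x, G (F' x) = 0 := by
    intro x
    have : G ∘ₗ F' = 0 := by
      rw [← LinearMap.baseChange_comp, LinearMap.snd_comp_inl, LinearMap.baseChange_zero]
    exact LinearMap.congr_fun this x
  have hFG' : ∀ x, F (G' x) = 0 := by
    intro x
    have : F ∘ₗ G' = 0 := by
      rw [← LinearMap.baseChange_comp, LinearMap.fst_comp_inr, LinearMap.baseChange_zero]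
    exact LinearMap.congr_fun this x
  have hGG' : ∀ x, G (G' x) = x := by
    intro x
    have : G ∘ₗ G' = LinearMap.id := by
      rw [← LinearMap.baseChange_comp, LinearMap.snd_comp_inr, LinearMap.baseChange_id]
    exact LinearMap.congr_fun this x
  have hFκ : ∀ x, F (κ.baseChange S x) = φ₀.baseChange S x := by
    intro x
    have : F ∘ₗ κ.baseChange S = φ₀.baseChange S := by
      rw [← LinearMap.baseChange_comp]; rfl
    exact LinearMap.congr_fun this x
  have hGκ : ∀ x, G (κ.baseChange S x) = -ι.baseChange S x := by
    intro x
    have : G ∘ₗ κ.baseChange S = -ι.baseChange S := by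
      rw [← LinearMap.baseChange_comp, ← LinearMap.baseChange_neg]; rfl
    exact LinearMap.congr_fun this x
  let Θ : S ⊗[R] (A₀ × (Fin k → R)) →ₗ[S] N := f ∘ₗ F + h' ∘ₗ G
  have hΘ : Surjective Θ := by
    intro y
    obtain ⟨x, hx⟩ := LinearMap.lTensor_surjective S hπ (g y)
    obtain ⟨a, ha⟩ := (hfg (y - h' x)).1 (by rw [map_sub, hh', sub_eq_zero]; exact hx.symm)
    refine ⟨F' a + G' x, ?_⟩
    simp [Θ, hFF', hFG', hGF', hGG', ha]
  have hker : LinearMap.ker Θ = LinearMap.range (κ.baseChange S) := by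
    apply le_antisymm
    · intro z hz
      have hz' : f (F z) + h' (G z) = 0 := hz
      obtain ⟨x, hx⟩ := (hexK (G z)).1 (by
        rw [← hh']
        have := congrArg g hz'
        rwa [map_add, hgf, zero_add, map_zero] at this)
      refine ⟨-x, ?_⟩
      have h1 : F z = -φ₀.baseChange S x := by
        apply hf
        rw [map_neg, hφ', hx]
        exact eq_neg_of_add_eq_zero_left hz'
      rw [hid z, hid (κ.baseChange S (-x)), hFκ, hGκ, map_neg (ι.baseChange S), neg_neg,
        map_neg (φ₀.baseChange S), hx, h1]
    · rintro _ ⟨x, rfl⟩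
      change f (F (κ.baseChange S x)) + h' (G (κ.baseChange S x)) = 0
      rw [hFκ, hGκ, map_neg, hφ', add_neg_cancel]
  have hex : Exact (κ.baseChange S) ((LinearMap.range κ).mkQ.baseChange S) :=
    lTensor_exact S (f := κ) (g := (LinearMap.range κ).mkQ)
      (by rw [LinearMap.exact_iff]; simp) (Submodule.mkQ_surjective _)
  have hsurj : Surjective ((LinearMap.range κ).mkQ.baseChange S) :=
    LinearMap.lTensor_surjective S (Submodule.mkQ_surjective _)
  exact ⟨(A₀ × (Fin k → R)) ⧸ LinearMap.range κ, _, _, inferInstance,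
    ⟨(Θ.quotKerEquivOfSurjective hΘ).symm ≪≫ₗ Submodule.quotEquivOfEq _ _
      (hker.trans (LinearMap.exact_iff.1 hex).symm) ≪≫ₗ
      LinearMap.quotKerEquivOfSurjective _ hsurj⟩⟩

end Extended

/-! ### The divisor class decides whether a module is extended. -/

section Classes

open IsLocalRing Function TensorProduct FractionalIdeal

section

variable {A : Type u} [CommRing A] [IsDomain A]

/-- The class of an ideal modulo `DivisorialEquiv`. -/
def idealClass (J : Ideal A) : (divisorialCon A).Quotient :=
  ((J : FractionalIdeal A⁰ (FractionRing A)) : (divisorialCon A).Quotient)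

theorem idealClass_mul (I J : Ideal A) : idealClass (I * J) = idealClass I * idealClass J := by
  rw [idealClass, coeIdeal_mul, Con.coe_mul]; rfl

theorem idealClass_span_singleton {b : A} (hb : b ≠ 0) : idealClass (Ideal.span {b}) = 1 := by
  rw [idealClass, ← Con.coe_one]
  refine (Con.eq _).2 ((divisorialEquiv_iff _ _).2
    ⟨(algebraMap A (FractionRing A) b)⁻¹, by simpa using hb, ?_⟩)
  rw [coeIdeal_span_singleton, ← mul_one (spanSingleton A⁰ (algebraMap A (FractionRing A) b)),
    fracIdeal_singleton_mul_inv (by simpa using hb)]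

variable [IsLocalRing A] [IsNoetherianRing A] [IsIntegrallyClosed A]

/-- The colon ideal `(J : I)` contains some `𝔪 ^ n`. For `y ∈ J⁻¹` this gives `𝔪 ^ n y I ⊆ A`, hence
`y I ⊆ A` by the depth-two property. -/
theorem CodimOneLE.inv_le (hdim : ringKrullDim A = 2) {I J : Ideal A} (hI : I ≠ ⊥) (hJ : J ≠ ⊥)
    (h : CodimOneLE I J) : (J : FractionalIdeal A⁰ (FractionRing A))⁻¹ ≤
      (I : FractionalIdeal A⁰ (FractionRing A))⁻¹ := by
  obtain ⟨n, hn⟩ := exists_pow_le_of_forall_not_le hdim (I := Submodule.colon J (I : Set A))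
    (fun q hq hle => by
      obtain ⟨s, hs, h⟩ := h q hq
      exact hs (hle (Submodule.mem_colon.2 fun x hx => h x hx)))
  intro y hy
  have hJ' : (J : FractionalIdeal A⁰ (FractionRing A)) ≠ 0 := by simpa using hJ
  have hI' : (I : FractionalIdeal A⁰ (FractionRing A)) ≠ 0 := by simpa using hI
  refine (mem_inv_iff hI').2 fun x hx => ?_
  obtain ⟨a, ha, rfl⟩ := (mem_coeIdeal _).1 hx
  obtain ⟨t, ht⟩ := mem_range_of_pow_smul_mem_range hdim n
    (y * algebraMap A (FractionRing A) a) (fun c hc => by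
      have h1 : c • a ∈ J := Submodule.mem_colon.1 (hn hc) a ha
      obtain ⟨t, ht⟩ := (mem_one_iff _).1 ((mem_inv_iff hJ').1 hy _ (mem_coeIdeal_of_mem _ h1))
      refine ⟨t, ht.trans ?_⟩
      rw [smul_eq_mul, map_mul, Algebra.smul_def]; ring)
  exact (mem_one_iff _).2 ⟨t, ht⟩

theorem idealClass_eq_of_codimOneLE (hdim : ringKrullDim A = 2) {I J : Ideal A} (hI : I ≠ ⊥)
    (hJ : J ≠ ⊥) (hIJ : CodimOneLE I J) (hJI : CodimOneLE J I) : idealClass I = idealClass J :=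
  (Con.eq _).2 ((divisorialEquiv_iff _ _).2 ⟨1, one_ne_zero, by
    simpa using le_antisymm (hJI.inv_le hdim hJ hI) (hIJ.inv_le hdim hI hJ)⟩)

/-- An ideal agrees with its divisorial hull in codimension one: if `g` generates `J` at `q` with
multiplier `s`, then `s / g ∈ J⁻¹`, so `s y ∈ g A ⊆ J` for every `y` in the hull. -/
theorem exists_pow_smul_inv_inv_le (hdim : ringKrullDim A = 2) {J : Ideal A} (hJ : J ≠ ⊥) :
    ∃ n, ∀ c ∈ maximalIdeal A ^ n, ∀ y ∈ (J : FractionalIdeal A⁰ (FractionRing A))⁻¹⁻¹,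
      ∃ j ∈ J, algebraMap A (FractionRing A) j = c • y := by
  have hJ' : (J : FractionalIdeal A⁰ (FractionRing A)) ≠ 0 := by simpa using hJ
  let D : Ideal A :=
    { carrier := {c | ∀ y ∈ (J : FractionalIdeal A⁰ (FractionRing A))⁻¹⁻¹,
        ∃ j ∈ J, algebraMap A (FractionRing A) j = c • y}
      add_mem' := by
        intro a b ha hb y hy
        obtain ⟨j, hj, h1⟩ := ha y hy
        obtain ⟨k, hk, h2⟩ := hb y hy
        exact ⟨j + k, add_mem hj hk, by rw [map_add, h1, h2, add_smul]⟩
      zero_mem' := fun y _ => ⟨0, zero_mem _, by simp⟩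
      smul_mem' := by
        intro a b hb y hy
        obtain ⟨k, hk, h2⟩ := hb y hy
        exact ⟨a * k, J.mul_mem_left a hk, by
          rw [map_mul, h2, smul_assoc, Algebra.smul_def a]⟩ }
  refine (exists_pow_le_of_forall_not_le hdim (I := D) fun q hq hle => ?_).imp
    fun n hn c hc => hn hc
  obtain ⟨g, hg, hg0, s, hs, hdvd⟩ := exists_local_generator hdim hq hJ
  refine hs (hle fun y hy => ?_)
  have hg0' : algebraMap A (FractionRing A) g ≠ 0 := by simpa using hg0
  have h1 : algebraMap A (FractionRing A) s * (algebraMap A (FractionRing A) g)⁻¹ ∈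
      (J : FractionalIdeal A⁰ (FractionRing A))⁻¹ := by
    refine (mem_inv_iff hJ').2 fun x hx => ?_
    obtain ⟨j, hj, rfl⟩ := (mem_coeIdeal _).1 hx
    obtain ⟨t, ht⟩ := hdvd j hj
    refine (mem_one_iff _).2 ⟨t, ?_⟩
    have := congrArg (algebraMap A (FractionRing A)) ht
    rw [map_mul, map_mul] at this
    field_simp
    rw [this]; ring
  obtain ⟨t, ht⟩ := (mem_one_iff _).1 ((mem_inv_iff (fracIdeal_inv_ne_zero hJ')).1 hy _ h1)
  refine ⟨g * t, J.mul_mem_right t hg, ?_⟩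
  rw [map_mul, ht, Algebra.smul_def]
  field_simp

end

variable {R S : Type u} [CommRing R] [IsDomain R] [IsLocalRing R] [IsNoetherianRing R]
  [CommRing S] [IsDomain S] [IsLocalRing S] [IsNoetherianRing S] [IsIntegrallyClosed S]
  [Algebra R S] [Module.Flat R S] [IsCompletionLike R S]

/-- Inverses commute with flat extension, so the hull of `J` is a multiple of an ideal `𝔞` of `R`
extended to `S`, and is isomorphic to `S ⊗ 𝔞`. Inside it `J` contains a power of `𝔪` times
everything, so `isExtended_of_pow_smul_le` applies. -/
theorem isExtended_of_idealClass_eq (hdim : ringKrullDim S = 2) {J : Ideal S} (hJ : J ≠ ⊥)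
    (I : FractionalIdeal R⁰ (FractionRing R))
    (h : idealClass J = ((extendedHom (FractionRing S) S I : FractionalIdeal S⁰ (FractionRing S)) :
      (divisorialCon S).Quotient)) : IsExtended R (S := S) J := by
  obtain ⟨x, hx0, hx⟩ := (Con.eq _).1 h
  have hinj := FaithfulSMul.algebraMap_injective R S
  rw [← extended_inv, ← extended_inv] at hx
  set I' := I⁻¹⁻¹
  have hden : algebraMap R (FractionRing R) (I'.den : R) ≠ 0 := by simp
  set d : FractionRing S := algebraMap S (FractionRing S) (algebraMap R S I'.den)
  have hd : d ≠ 0 := by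
    simp [d, hinj.eq_iff' (map_zero _)]
  have h1 := den_mul_self_eq_num' R⁰ (FractionRing R) I'
  have h2 := congrArg (extendedHom (FractionRing S) S) h1
  rw [map_mul, extendedHom_coeIdeal_eq_map, extendedHom_spanSingleton, IsFractionRing.map,
    IsLocalization.map_eq] at h2
  set 𝔞 := I'.num
  have h3 : (J : FractionalIdeal S⁰ (FractionRing S))⁻¹⁻¹ = spanSingleton S⁰ (x * d⁻¹) *
      (𝔞.map (algebraMap R S) : Ideal S) := by
    rw [hx, ← h2, ← mul_assoc, spanSingleton_mul_spanSingleton, mul_assoc,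
      inv_mul_cancel₀ hd, mul_one]
  have hJ' : (J : FractionalIdeal S⁰ (FractionRing S)) ≠ 0 := by simpa using hJ
  have hJle : (J : FractionalIdeal S⁰ (FractionRing S)) ≤
      (J : FractionalIdeal S⁰ (FractionRing S))⁻¹⁻¹ := by
    intro y hy
    refine (mem_inv_iff (fracIdeal_inv_ne_zero hJ')).2 fun z hz => ?_
    rw [mul_comm]
    exact (mem_inv_iff hJ').1 hz y hy
  have hy0 : x * d⁻¹ ≠ 0 := mul_ne_zero hx0 (inv_ne_zero hd)
  obtain ⟨n, hn⟩ := exists_pow_smul_inv_inv_le hdim hJ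
  let θ : S ⊗[R] 𝔞 →ₗ[S] S :=
    (AlgebraTensorModule.rid R S S).toLinearMap ∘ₗ (𝔞.subtype.baseChange S)
  have hθ : Injective θ := (AlgebraTensorModule.rid R S S).injective.comp
    (Module.Flat.lTensor_preserves_injective_linearMap 𝔞.subtype 𝔞.injective_subtype)
  have hθt : ∀ s (a : 𝔞), θ (s ⊗ₜ a) = s * algebraMap R S a := by
    intro s a
    simp [θ, Algebra.smul_def, mul_comm]
  have hθr : LinearMap.range θ = 𝔞.map (algebraMap R S) := by
    apply le_antisymm
    · rintro _ ⟨t, rfl⟩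
      induction t with
      | zero => simp
      | add a b ha hb => rw [map_add]; exact add_mem ha hb
      | tmul s a => rw [hθt]; exact Ideal.mul_mem_left _ _ (Ideal.mem_map_of_mem _ a.2)
    · refine Ideal.map_le_iff_le_comap.2 fun a ha => ?_
      exact ⟨1 ⊗ₜ ⟨a, ha⟩, by rw [hθt, one_mul]⟩
  -- `δ` is an isomorphism of `S ⊗ 𝔞` onto the divisorial hull of `J` in the fraction field.
  let δ : S ⊗[R] 𝔞 →ₗ[S] FractionRing S :=
    LinearMap.toSpanSingleton S (FractionRing S) (x * d⁻¹) ∘ₗ θ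
  have hδ : Injective δ := (smul_left_injective S hy0).comp hθ
  have hδmem : ∀ y, y ∈ (J : FractionalIdeal S⁰ (FractionRing S))⁻¹⁻¹ ↔ ∃ t, δ t = y := by
    intro y
    rw [h3, mem_singleton_mul]
    constructor
    · rintro ⟨z, hz, rfl⟩
      obtain ⟨w, hw, rfl⟩ := (mem_coeIdeal _).1 hz
      obtain ⟨t, rfl⟩ : w ∈ LinearMap.range θ := hθr.ge hw
      exact ⟨t, by simp only [δ, LinearMap.comp_apply, LinearMap.toSpanSingleton_apply,
        Algebra.smul_def, mul_comm]⟩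
    · rintro ⟨t, rfl⟩
      refine ⟨algebraMap S (FractionRing S) (θ t), mem_coeIdeal_of_mem _ (hθr ▸ ⟨t, rfl⟩), ?_⟩
      simp only [δ, LinearMap.comp_apply, LinearMap.toSpanSingleton_apply, Algebra.smul_def,
        mul_comm]
  let JK : Submodule S (FractionRing S) := Submodule.map (Algebra.linearMap S (FractionRing S)) J
  have hJK : JK ≤ LinearMap.range δ := by
    rintro _ ⟨j, hj, rfl⟩
    exact (hδmem _).1 (hJle (mem_coeIdeal_of_mem _ hj))
  have hext : IsExtended R (S := S) (JK.comap δ) := by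
    refine isExtended_of_pow_smul_le R _ n ?_
    rw [Submodule.smul_le]
    intro c hc t _
    obtain ⟨j, hj, hjc⟩ := hn c hc (δ t) ((hδmem _).2 ⟨t, rfl⟩)
    exact ⟨j, hj, by rw [map_smul, ← hjc]; rfl⟩
  refine hext.congr ?_
  exact (Submodule.equivMapOfInjective δ hδ _) ≪≫ₗ
    LinearEquiv.ofEq _ _ (Submodule.map_comap_eq_of_le hJK) ≪≫ₗ
    (Submodule.equivMapOfInjective (Algebra.linearMap S (FractionRing S))
      (IsFractionRing.injective S (FractionRing S)) J).symm

theorem HasFlag.isTorsionFree {A : Type u} [CommRing A] [IsDomain A] {l : List (Ideal A)}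
    {M : Type u} [AddCommGroup M] [Module A M] (h : HasFlag l M) : Module.IsTorsionFree A M := by
  induction l generalizing M with
  | nil =>
    have : Subsingleton M := h
    infer_instance
  | cons J l ih =>
    obtain ⟨N, _, _, f, g, -, hf, -, hfg, hN⟩ := h
    have := ih hN
    rw [Module.isTorsionFree_iff_smul_eq_zero]
    intro a x hax
    by_cases ha : a = 0
    · exact Or.inl ha
    have hgx : g x = 0 := (smul_eq_zero.1 (by rw [← map_smul, hax, map_zero] :
      a • g x = 0)).resolve_left ha
    obtain ⟨j, rfl⟩ := (hfg x).1 hgx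
    rw [← map_smul, map_eq_zero_iff f hf] at hax
    exact Or.inr (by rw [(smul_eq_zero.1 hax).resolve_left ha, map_zero])

/-- Induction on the length of the flag. The product of classes is preserved when the two bottom
ideals are traded for `I₁`, of trivial class, and `I₂`, of class `[J₁ J₂]`; then both `I₁` and the
quotient by it are extended. -/
theorem isExtended_of_hasFlag [IsIntegrallyClosed R] (hR : ringKrullDim R = 2)
    (hS : ringKrullDim S = 2) {l : List (Ideal S)} {N : Type u} [AddCommGroup N] [Module S N]
    (hN : HasFlag l N) (I : FractionalIdeal R⁰ (FractionRing R))
    (h : (l.map idealClass).prod =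
      ((extendedHom (FractionRing S) S I : FractionalIdeal S⁰ (FractionRing S)) :
      (divisorialCon S).Quotient)) : IsExtended R (S := S) N := by
  induction hl : l.length using Nat.strong_induction_on generalizing l N with
  | _ k ih =>
  have htf := hN.isTorsionFree
  match l, hN with
  | [], hN =>
    have : Subsingleton N := hN
    exact ⟨PUnit, inferInstance, inferInstance, inferInstance, ⟨0⟩⟩
  | [J], hN =>
    obtain ⟨N', _, _, f, g, hJ, hf, hg, hfg, hN'⟩ := hN
    have : Subsingleton N' := hN'
    refine (isExtended_of_idealClass_eq hS hJ I (by simpa using h)).congr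
      (LinearEquiv.ofBijective f ⟨hf, fun x => (hfg x).1 (Subsingleton.elim _ _)⟩)
  | J₁ :: J₂ :: l, hN =>
    obtain ⟨N', _, _, i₁, g, hJ₁, hi₁, hg, hig, N'', _, _, i₂, g', hJ₂, hi₂, hg', hig', hN''⟩ := hN
    -- `N₂` is the preimage of `J₂` in `N`, an extension of `J₂` by `J₁`.
    let N₂ := LinearMap.ker (g' ∘ₗ g)
    obtain ⟨i, hi⟩ := N₂.subtype.exists_comp_eq_of_injective N₂.injective_subtype i₁ (fun j => by
      simp [N₂, hig.apply_apply_eq_zero])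
    obtain ⟨p, hp⟩ := i₂.exists_comp_eq_of_injective hi₂ (g ∘ₗ N₂.subtype) (fun x =>
      (hig' _).1 x.2)
    have hinj : Injective i := by
      intro a b hab
      apply hi₁
      rw [← hi, ← hi, hab]
    have hsurj : Surjective p := by
      intro j
      obtain ⟨x, hx⟩ := hg (i₂ j)
      exact ⟨⟨x, by
        change g' (g x) = 0
        rw [hx]; exact hig'.apply_apply_eq_zero j⟩, hi₂ (by rw [hp]; exact hx)⟩
    have hexact : Exact i p := by
      intro x
      rw [← map_eq_zero_iff i₂ hi₂, hp]
      change g (x : N) = 0 ↔ _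
      rw [hig]
      constructor
      · rintro ⟨j, hj⟩; exact ⟨j, Subtype.ext ((hi j).trans hj)⟩
      · rintro ⟨j, rfl⟩; exact ⟨j, (hi j).symm⟩
    obtain ⟨I₁, I₂, i', p', hI₂, hi', hp', hip', ⟨b, hb0, hb1, hb2⟩, hI₂J, hJI₂⟩ :=
      exists_extension_of_extension hS hJ₁ hJ₂ i p hinj hsurj hexact
    have hspan : Ideal.span {b} ≠ ⊥ := by simpa using hb0
    have hI₁ : I₁ ≠ ⊥ := by
      rintro rfl
      obtain ⟨q, hq⟩ := exists_isCodimOne hS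
      obtain ⟨s, hs, h⟩ := hb2 q hq
      have := h b (Ideal.mem_span_singleton_self b)
      rw [Ideal.mem_bot, mul_eq_zero] at this
      exact this.elim (fun h => hs (h ▸ q.zero_mem)) hb0
    let f₁ : I₁ →ₗ[S] N := N₂.subtype ∘ₗ i'
    have hf₁ : Injective f₁ := N₂.injective_subtype.comp hi'
    obtain ⟨f₂, hf₂⟩ := p'.exists_comp_eq_of_surjective hp' ((LinearMap.range f₁).mkQ ∘ₗ N₂.subtype)
      (fun x hx => by
        obtain ⟨j, rfl⟩ := (hip' x).1 hx
        exact (Submodule.Quotient.mk_eq_zero _).2 ⟨j, rfl⟩)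
    let g₂ : (N ⧸ LinearMap.range f₁) →ₗ[S] N'' := (LinearMap.range f₁).liftQ (g' ∘ₗ g) (by
      rintro _ ⟨j, rfl⟩
      exact (i' j).2)
    have hflag : HasFlag (I₂ :: l) (N ⧸ LinearMap.range f₁) := by
      refine ⟨N'', _, _, f₂, g₂, hI₂, ?_, ?_, ?_, hN''⟩
      · rw [injective_iff_map_eq_zero]
        intro y hy
        obtain ⟨x, rfl⟩ := hp' y
        rw [hf₂] at hy
        obtain ⟨j, hj⟩ := (Submodule.Quotient.mk_eq_zero _).1 hy
        rw [← N₂.injective_subtype hj]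
        exact hip'.apply_apply_eq_zero j
      · intro z
        obtain ⟨y, rfl⟩ := hg' z
        obtain ⟨x, rfl⟩ := hg y
        exact ⟨Submodule.Quotient.mk x, rfl⟩
      · intro y
        obtain ⟨y, rfl⟩ := Submodule.Quotient.mk_surjective _ y
        constructor
        · intro hy
          exact ⟨p' ⟨y, hy⟩, hf₂ _⟩
        · rintro ⟨z, hz⟩
          obtain ⟨x, rfl⟩ := hp' z
          rw [hf₂] at hz
          rw [← hz]
          exact x.2
    have hquot := hflag.isTorsionFree
    refine IsExtended.of_extension R hR f₁ (LinearMap.range f₁).mkQ hf₁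
      (Submodule.mkQ_surjective _) (by rw [LinearMap.exact_iff]; simp) ?_ ?_
    · refine isExtended_of_idealClass_eq hS hI₁ 1 ?_
      rw [idealClass_eq_of_codimOneLE hS hI₁ hspan hb1 hb2, idealClass_span_singleton hb0, map_one,
        Con.coe_one]
    · refine ih (l.length + 1) (by rw [← hl]; simp) hflag ?_ rfl
      rw [← h]
      simp only [List.map_cons, List.prod_cons]
      rw [idealClass_eq_of_codimOneLE hS hI₂ (by simpa using ⟨hJ₁, hJ₂⟩) hI₂J hJI₂,
        idealClass_mul, mul_assoc]

end Classes

/-! ### Attainment of the Davenport constant. -/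

section Davenport

/-- The infimum is attained once the set is nonempty, and `|G|` belongs to it: two of the `|G| + 1`
partial products of a sequence of length `|G|` coincide, so the block of terms between them has
product `1`. -/
theorem davenportConstant_spec (G : Type*) [CommGroup G] [Finite G] (s : Fin (davenportConstant G) → G) :
    ∃ T : Finset (Fin (davenportConstant G)), T.Nonempty ∧ ∏ i ∈ T, s i = 1 := by
  classical
  have := Fintype.ofFinite G
  refine (Nat.sInf_mem (s := {d : ℕ | 0 < d ∧ ∀ s : Fin d → G, ∃ T : Finset (Fin d),
    T.Nonempty ∧ ∏ i ∈ T, s i = 1}) ⟨Fintype.card G, Fintype.card_pos, fun s => ?_⟩).2 s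
  let p : Fin (Fintype.card G + 1) → G := fun k =>
    ∏ i ∈ Finset.univ.filter (fun i : Fin (Fintype.card G) => i.1 < k.1), s i
  obtain ⟨k, k', hne, hp⟩ := Fintype.exists_ne_map_eq_of_card_lt p (by simp)
  wlog hlt : k < k' generalizing k k'
  · exact this k' k hne.symm hp.symm (lt_of_le_of_ne (not_lt.1 hlt) hne.symm)
  refine ⟨Finset.univ.filter fun i => k.1 ≤ i.1 ∧ i.1 < k'.1,
    ⟨⟨k.1, by omega⟩, by simpa using hlt⟩, ?_⟩
  have h : p k * ∏ i ∈ Finset.univ.filter (fun i : Fin (Fintype.card G) => k.1 ≤ i.1 ∧ i.1 < k'.1),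
      s i = p k' := by
    rw [← Finset.prod_union (Finset.disjoint_filter.2 fun i _ h1 h2 => by omega)]
    congr 1
    ext i
    have : k.1 < k'.1 := hlt
    simp only [Finset.mem_union, Finset.mem_filter, Finset.mem_univ, true_and]
    omega
  rwa [← hp, mul_eq_left] at h

end Davenport

/-! ### Counting the indecomposable summands of a completed module. -/

section Summands

open IsLocalRing Function TensorProduct

theorem exists_isIndecomposableModule_decomposition (A X : Type u) [CommRing A] [AddCommGroup X]
    [Module A X] [IsNoetherian A X] :
    ∃ V : Finset (Submodule A X), V.SupIndep id ∧ V.sup id = ⊤ ∧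
      ∀ N ∈ V, IsIndecomposableModule A N := by
  classical
  suffices h : ∀ U W : Submodule A X, IsCompl U W → ∃ V : Finset (Submodule A X),
      V.SupIndep id ∧ V.sup id = W ∧ ∀ N ∈ V, IsIndecomposableModule A N from h _ _ isCompl_bot_top
  -- The ascending chain condition is applied to the complement `U`: splitting `W` as `N' ⊕ P'`
  -- leaves `N'` with the strictly larger complement `U ⊔ P'`.
  intro U
  induction U using WellFoundedGT.induction with
  | ind U ih =>
    intro W hUW
    by_cases hW : W = ⊥
    · exact ⟨∅, Finset.supIndep_empty _, by simp [hW], by simp⟩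
    by_cases hind : IsIndecomposableModule A W
    · exact ⟨{W}, Finset.supIndep_singleton _ _, by simp, by simpa using hind⟩
    have hnt : Nontrivial W := Submodule.nontrivial_iff_ne_bot.2 hW
    simp only [IsIndecomposableModule, hnt, true_and, not_forall, not_or] at hind
    obtain ⟨N, P, hNP, hN, hP⟩ := hind
    have hd : Disjoint (N.map W.subtype) (P.map W.subtype) :=
      (Submodule.disjoint_map W.injective_subtype hNP.disjoint)
    have hs : N.map W.subtype ⊔ P.map W.subtype = W := by
      rw [← Submodule.map_sup, hNP.sup_eq_top, Submodule.map_top, Submodule.range_subtype]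
    have key : ∀ N' P' : Submodule A X, Disjoint N' P' → N' ⊔ P' = W → P' ≠ ⊥ →
        ∃ V : Finset (Submodule A X), V.SupIndep id ∧ V.sup id = N' ∧
          ∀ N ∈ V, IsIndecomposableModule A N := by
      intro N' P' hd hs hP'
      refine ih (U ⊔ P') (lt_of_le_of_ne le_sup_left fun h => hP' ?_) N' ⟨?_, ?_⟩
      · have h1 : P' ≤ U := h ▸ le_sup_right
        exact le_bot_iff.1 (hUW.disjoint h1 (hs ▸ le_sup_right))
      · rw [disjoint_comm]
        rw [← hs] at hUW
        rw [sup_comm]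
        exact hd.disjoint_sup_right_of_disjoint_sup_left hUW.disjoint.symm
      · rw [codisjoint_iff, sup_assoc, sup_comm P', hs, hUW.sup_eq_top]
    obtain ⟨V₁, h₁, hs₁, hi₁⟩ := key _ _ hd hs
      (fun h => hP (Submodule.map_injective_of_injective W.injective_subtype
        (h.trans (Submodule.map_bot _).symm)))
    obtain ⟨V₂, h₂, hs₂, hi₂⟩ := key _ _ hd.symm (by rw [sup_comm, hs])
      (fun h => hN (Submodule.map_injective_of_injective W.injective_subtype
        (h.trans (Submodule.map_bot _).symm)))
    refine ⟨V₁ ∪ V₂, h₁.union h₂ (by rwa [hs₁, hs₂]), by rw [Finset.sup_union, hs₁, hs₂, hs], ?_⟩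
    intro N hN
    rcases Finset.mem_union.1 hN with h | h
    exacts [hi₁ N h, hi₂ N h]

section

variable (R : Type u) {S : Type u} [CommRing R] [CommRing S] [Algebra R S] [IsLocalRing R]
  [IsLocalRing S] [IsCompletionLike R S] [IsNoetherianRing R] [Module.Flat R S]

/-- `Hom` out of a finitely presented module commutes with flat base change, and every coefficient
in `S` is congruent modulo `𝔪` to one from `R`. -/
theorem exists_sub_baseChange_mem {M N : Type u} [AddCommGroup M] [Module R M] [Module.Finite R M]
    [AddCommGroup N] [Module R N] (φ : S ⊗[R] M →ₗ[S] S ⊗[R] N) :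
    ∃ φ₀ : M →ₗ[R] N, ∀ x, φ x - φ₀.baseChange S x ∈
      maximalIdeal S • (⊤ : Submodule S (S ⊗[R] N)) := by
  have : Module.FinitePresentation R M := Module.finitePresentation_of_finite R M
  refine (Module.FinitePresentation.isBaseChange_map R M N S).inductionOn φ
    (fun φ => ∃ φ₀ : M →ₗ[R] N, ∀ x, φ x - φ₀.baseChange S x ∈
      maximalIdeal S • (⊤ : Submodule S (S ⊗[R] N))) ?_ ?_ ?_ ?_
  · exact ⟨0, by simp⟩
  · intro φ₀
    exact ⟨φ₀, fun x => by simp⟩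
  · rintro s φ ⟨φ₀, h⟩
    obtain ⟨r, hr⟩ := IsCompletionLike.exists_sub_mem (R := R) s
    refine ⟨r • φ₀, fun x => ?_⟩
    have h1 : (s • φ) x - (r • φ₀).baseChange S x =
        s • (φ x - φ₀.baseChange S x) + (s - algebraMap R S r) • φ₀.baseChange S x := by
      rw [_root_.sub_smul s (algebraMap R S r) (φ₀.baseChange S x), LinearMap.baseChange_smul,
        LinearMap.smul_apply, LinearMap.smul_apply, smul_sub, algebraMap_smul]
      abel
    rw [h1]
    exact add_mem (Submodule.smul_mem _ _ (h x)) (Submodule.smul_mem_smul hr trivial)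
  · rintro φ₁ φ₂ ⟨ψ₁, h₁⟩ ⟨ψ₂, h₂⟩
    refine ⟨ψ₁ + ψ₂, fun x => ?_⟩
    have := add_mem (h₁ x) (h₂ x)
    rw [LinearMap.baseChange_add, LinearMap.add_apply, LinearMap.add_apply]
    convert this using 1
    abel

/-- The inclusion `f` and the projection `g` are approximated modulo `𝔪` by maps `f₀`, `g₀` over
`R`. Since `g₀ f₀` is the identity modulo `𝔪` after base change, it is surjective by Nakayama and
faithful flatness, hence bijective. So `N₀` is a direct summand of `M`. -/
theorem eq_bot_or_eq_bot_of_isExtended [IsNoetherianRing S] {M : Type u} [AddCommGroup M]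
    [Module R M] [Module.Finite R M] (hM : IsIndecomposableModule R M)
    {N P : Submodule S (S ⊗[R] M)} (hNP : IsCompl N P) (hN : IsExtended R (S := S) N) :
    N = ⊥ ∨ P = ⊥ := by
  obtain ⟨N₀, _, _, _, ⟨e⟩⟩ := hN
  let f : S ⊗[R] N₀ →ₗ[S] S ⊗[R] M := N.subtype ∘ₗ e.symm.toLinearMap
  let g : S ⊗[R] M →ₗ[S] S ⊗[R] N₀ := e.toLinearMap ∘ₗ N.projectionOnto P hNP
  have hgf : ∀ x, g (f x) = x := fun x => by simp [f, g]
  have hg : LinearMap.ker g = P := by simp [g]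
  obtain ⟨f₀, hf₀⟩ := exists_sub_baseChange_mem R f
  obtain ⟨g₀, hg₀⟩ := exists_sub_baseChange_mem R g
  have hmap : ∀ {X Y : Type u} [AddCommGroup X] [Module S X] [AddCommGroup Y] [Module S Y]
      (φ : X →ₗ[S] Y), ∀ x ∈ maximalIdeal S • (⊤ : Submodule S X),
      φ x ∈ maximalIdeal S • (⊤ : Submodule S Y) := by
    intro X Y _ _ _ _ φ x hx
    have : (maximalIdeal S • (⊤ : Submodule S X)).map φ ≤ maximalIdeal S • (⊤ : Submodule S Y) := by
      rw [Submodule.map_smul'']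
      exact Submodule.smul_mono le_rfl le_top
    exact this ⟨x, hx, rfl⟩
  have hmem : ∀ x, x - (g₀ ∘ₗ f₀).baseChange S x ∈
      maximalIdeal S • (⊤ : Submodule S (S ⊗[R] N₀)) := by
    intro x
    have h1 := hmap g _ (hf₀ x)
    have h2 := hg₀ (f₀.baseChange S x)
    have := add_mem h1 h2
    rw [map_sub, hgf] at this
    rw [LinearMap.baseChange_comp]
    simpa using this
  have htop : LinearMap.range ((g₀ ∘ₗ f₀).baseChange S) = ⊤ := by
    rw [eq_top_iff]
    refine Submodule.le_of_le_smul_of_le_jacobson_bot Module.Finite.fg_top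
      (maximalIdeal_le_jacobson _) fun x _ => ?_
    have := Submodule.add_mem_sup (LinearMap.mem_range_self ((g₀ ∘ₗ f₀).baseChange S) x) (hmem x)
    simpa using this
  have := IsCompletionLike.faithfullyFlat R S
  have hsurj : Surjective (g₀ ∘ₗ f₀) := by
    rw [← Module.FaithfullyFlat.lTensor_surjective_iff_surjective R S]
    have := LinearMap.range_eq_top.1 htop
    exact this
  let u := LinearEquiv.ofBijective (g₀ ∘ₗ f₀)
    (IsNoetherian.bijective_of_surjective_endomorphism _ hsurj)
  let h₀ : M →ₗ[R] N₀ := u.symm.toLinearMap ∘ₗ g₀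
  have hh₀ : ∀ x, h₀ (f₀ x) = x := fun x => u.symm_apply_apply x
  have hidem : IsIdempotentElem (f₀ ∘ₗ h₀) := by
    refine LinearMap.ext fun x => ?_
    change f₀ (h₀ (f₀ (h₀ x))) = f₀ (h₀ x)
    rw [hh₀]
  rcases hM.2 _ _ (LinearMap.IsIdempotentElem.isCompl hidem) with h | h
  · left
    have hN₀ : Subsingleton N₀ := by
      refine subsingleton_of_forall_eq 0 fun x => ?_
      have h1 : f₀ x = 0 := by
        have : f₀ (h₀ (f₀ x)) = 0 := LinearMap.congr_fun (LinearMap.range_eq_bot.1 h) (f₀ x)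
        rwa [hh₀] at this
      rw [← hh₀ x, h1, map_zero]
    have := e.toEquiv.subsingleton
    exact Submodule.subsingleton_iff_eq_bot.1 this
  · right
    have hinj : Injective h₀ := by
      rw [injective_iff_map_eq_zero]
      intro x hx
      have : x ∈ LinearMap.ker (f₀ ∘ₗ h₀) := by simp [hx]
      rwa [h, Submodule.mem_bot] at this
    let v := LinearEquiv.ofBijective h₀ ⟨hinj, fun x => ⟨f₀ x, hh₀ x⟩⟩
    -- Now `M ≅ N₀`, so `g` followed by this isomorphism is a surjective endomorphism of the
    -- Noetherian module `S ⊗ M`. It is injective, and its kernel is `P`.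
    have hvg : Surjective ((v.baseChange R S _ _).symm.toLinearMap ∘ₗ g) :=
      (v.baseChange R S _ _).symm.surjective.comp fun x => ⟨f x, hgf x⟩
    have := (IsNoetherian.bijective_of_surjective_endomorphism _ hvg).1
    rw [← hg, LinearMap.ker_eq_bot]
    exact Injective.of_comp this

end

theorem HasFlag.sup {A X : Type u} [CommRing A] [AddCommGroup X] [Module A X]
    {l l' : List (Ideal A)} {V W : Submodule A X} (h : Disjoint V W) (hV : HasFlag l V)
    (hW : HasFlag l' W) : HasFlag (l ++ l') ↥(V ⊔ W) := by
  have hinj : Injective (V.subtype.coprod W.subtype) := by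
    rw [← LinearMap.ker_eq_bot, LinearMap.ker_coprod_of_disjoint_range]
    · simp
    · simpa using h
  have h1 : HasFlag (l ++ l') (V × W) :=
    HasFlag.append (LinearMap.inl A V W) (LinearMap.snd A V W) LinearMap.inl_injective
      LinearMap.snd_surjective Function.Exact.inl_snd hV hW
  refine h1.congr (LinearEquiv.ofInjective _ hinj ≪≫ₗ LinearEquiv.ofEq _ _ ?_)
  rw [LinearMap.range_coprod, Submodule.range_subtype, Submodule.range_subtype]

theorem HasFlag.ne_bot {A : Type u} [CommRing A] {l : List (Ideal A)} {M : Type u} [AddCommGroup M]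
    [Module A M] (h : HasFlag l M) : ∀ J ∈ l, J ≠ ⊥ := by
  induction l generalizing M with
  | nil => simp
  | cons J l ih =>
    obtain ⟨N, _, _, f, g, hJ, -, -, -, hN⟩ := h
    simpa using ⟨hJ, ih hN⟩

theorem HasFlag.isUnit {A : Type u} [CommRing A] [IsDomain A] [IsNoetherianRing A]
    [IsIntegrallyClosed A] {l : List (Ideal A)} {M : Type u} [AddCommGroup M]
    [Module A M] (h : HasFlag l M) : IsUnit (l.map idealClass).prod := by
  have := h.ne_bot
  clear h
  induction l with
  | nil => simp
  | cons J l ih =>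
    simp only [List.mem_cons, forall_eq_or_imp] at this
    rw [List.map_cons, List.prod_cons]
    refine IsUnit.mul (isUnit_divisorialClass ?_) (ih this.2)
    simpa using this.1

/-- The inclusion of the divisor class group into the monoid of all divisorial classes. -/
def DivisorClassGroup.val {A : Type u} [CommRing A] [IsDomain A] :
    DivisorClassGroup A →* (divisorialCon A).Quotient :=
  Units.coeHom _

/-- Otherwise `D(G)` of the summands contain a nonempty subfamily with trivial product in `G`. Its
sum is extended and has a nonzero complement, against the indecomposability of `M`. -/
theorem card_le_davenportConstant {R S : Type u} [CommRing R] [IsDomain R] [IsLocalRing R]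
    [IsNoetherianRing R] [IsIntegrallyClosed R] [CommRing S] [IsDomain S] [IsLocalRing S]
    [IsNoetherianRing S] [IsIntegrallyClosed S] [Algebra R S] [Module.Flat R S]
    [IsCompletionLike R S] (hR : ringKrullDim R = 2) (hS : ringKrullDim S = 2)
    [Finite (DivisorClassCokernel R S)] {M : Type u} [AddCommGroup M] [Module R M]
    [Module.Finite R M] (hM : IsIndecomposableModule R M) [Module.IsTorsionFree S (S ⊗[R] M)]
    (V : Finset (Submodule S (S ⊗[R] M))) (hV : V.SupIndep id) (hV' : V.sup id = ⊤)
    (hbot : ∀ N ∈ V, N ≠ ⊥) : V.card ≤ davenportConstant (DivisorClassCokernel R S) := by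
  classical
  by_contra! hlt
  -- One flag is fixed for each summand. Independence of the class from the flag plays no role,
  -- because a direct sum is given the concatenated flag.
  have hc : ∀ N : Submodule S (S ⊗[R] M), ∃ c : DivisorClassGroup S, ∃ l, HasFlag (A := S) l N ∧
      (l.map idealClass).prod = c.val := by
    intro N
    obtain ⟨l, hl⟩ := exists_hasFlag (A := S) N
    exact ⟨hl.isUnit.unit, l, hl, hl.isUnit.unit_spec.symm⟩
  choose c hc using hc
  obtain ⟨U, hUV, hU⟩ := Finset.exists_subset_card_eq hlt.le
  let s := (Fintype.equivFinOfCardEq (α := U) (by simpa using hU)).symm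
  obtain ⟨T, hT, hT1⟩ := davenportConstant_spec (DivisorClassCokernel R S)
    (fun i => (QuotientGroup.mk (c (s i))))
  set T' : Finset (Submodule S (S ⊗[R] M)) := T.image fun i => (s i).1 with hT'
  have hT'V : T' ⊆ V := by
    intro N hN
    obtain ⟨i, _, rfl⟩ := Finset.mem_image.1 hN
    exact hUV (s i).2
  have hprod : ∏ N ∈ T', c N ∈ (DivisorClassGroup.map R S).range := by
    rw [hT', Finset.prod_image fun i _ j _ h => s.injective (Subtype.ext h),
      ← QuotientGroup.eq_one_iff, ← hT1]
    exact map_prod (QuotientGroup.mk' _) _ _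
  have hflag : ∀ T' ⊆ V, ∃ l, HasFlag (A := S) l ↥(T'.sup id) ∧
      (l.map idealClass).prod = DivisorClassGroup.val (∏ N ∈ T', c N) := by
    intro T' hT'
    induction T' using Finset.induction with
    | empty =>
      refine ⟨[], ?_, by simp⟩
      change Subsingleton _
      rw [Finset.sup_empty]
      infer_instance
    | insert N T' hN ih =>
      obtain ⟨hNV, hT'⟩ := Finset.insert_subset_iff.1 hT'
      obtain ⟨l, hl, hl'⟩ := ih hT'
      obtain ⟨l₁, hl₁, hl₁'⟩ := hc N
      refine ⟨l₁ ++ l, ?_, ?_⟩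
      · rw [Finset.sup_insert]
        exact HasFlag.sup (hV hT' hNV hN) hl₁ hl
      · rw [Finset.prod_insert hN, List.map_append, List.prod_append, hl', hl₁', map_mul]
  obtain ⟨y, hy⟩ := hprod
  obtain ⟨l, hl, hl'⟩ := hflag T' hT'V
  obtain ⟨I, hI⟩ := Con.mk'_surjective (c := divisorialCon R) y.val
  have hext : IsExtended R (S := S) ↥(T'.sup id) := by
    refine isExtended_of_hasFlag hR hS hl I ?_
    rw [hl', ← hy]
    change (Con.lift _ _ _) y.val = _
    rw [← hI]
    rfl
  have hcompl : IsCompl (T'.sup id) ((V \ T').sup id) := by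
    refine ⟨hV.disjoint_sup_sup hT'V Finset.sdiff_subset Finset.disjoint_sdiff, ?_⟩
    rw [codisjoint_iff, ← Finset.sup_union, Finset.union_sdiff_of_subset hT'V, hV']
  have hne : ∀ W : Finset (Submodule S (S ⊗[R] M)), W ⊆ V → W.Nonempty → W.sup id ≠ ⊥ := by
    rintro W hWV ⟨N, hN⟩ h
    exact hbot N (hWV hN) (le_bot_iff.1 (h ▸ Finset.le_sup (f := id) hN))
  rcases eq_bot_or_eq_bot_of_isExtended R hM hcompl hext with h | h
  · exact hne T' hT'V (hT.image _) h
  -- The complement is nonzero because `T'` has at most `D(G)` members and `V` has more.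
  · refine hne (V \ T') Finset.sdiff_subset (Finset.sdiff_nonempty.2 fun hVT => ?_) h
    have h1 := Finset.card_le_card hVT
    have h2 : T'.card ≤ T.card := Finset.card_image_le
    have h3 : T.card ≤ _ := Finset.card_le_univ T
    rw [Fintype.card_fin] at h3
    omega

end Summands

/-! ### Maximal Cohen–Macaulay modules, ranks and multiplicities. -/

section MaximalCohenMacaulay

open IsLocalRing Function TensorProduct

theorem isWeaklyRegular_pair_iff {A M : Type*} [CommRing A] [AddCommGroup M] [Module A M] (a b : A) :
    RingTheory.Sequence.IsWeaklyRegular M [a, b] ↔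
      (∀ x : M, a • x = 0 → x = 0) ∧ ∀ x y : M, b • x = a • y → ∃ z : M, x = a • z := by
  rw [RingTheory.Sequence.isWeaklyRegular_cons_iff, RingTheory.Sequence.isWeaklyRegular_cons_iff,
    isSMulRegular_iff_right_eq_zero_of_smul, isSMulRegular_iff_right_eq_zero_of_smul]
  refine and_congr_right fun _ => ?_
  rw [and_iff_left (RingTheory.Sequence.IsWeaklyRegular.nil _ _)]
  have hmem : ∀ x : M, (Submodule.Quotient.mk x : QuotSMulTop a M) = 0 ↔ ∃ z : M, x = a • z := by
    intro x
    rw [Submodule.Quotient.mk_eq_zero, Submodule.mem_smul_pointwise_iff_exists]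
    simp [eq_comm]
  constructor
  · intro h x y hxy
    refine (hmem x).1 (h _ ?_)
    rw [← Submodule.Quotient.mk_smul, hmem]
    exact ⟨y, hxy⟩
  · intro h x hx
    obtain ⟨x, rfl⟩ := Submodule.Quotient.mk_surjective _ x
    rw [← Submodule.Quotient.mk_smul, hmem] at hx
    obtain ⟨y, hy⟩ := hx
    exact (hmem x).2 (h x y hy)

theorem isMCM_iff_of_ringKrullDim_eq_two {A M : Type u} [CommRing A] [IsLocalRing A] [AddCommGroup M]
    [Module A M] (hdim : ringKrullDim A = 2) :
    IsMCM A M ↔ Module.Finite A M ∧ Nontrivial M ∧ ∃ a ∈ maximalIdeal A, ∃ b ∈ maximalIdeal A,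
      (∀ x : M, a • x = 0 → x = 0) ∧ ∀ x y : M, b • x = a • y → ∃ z : M, x = a • z := by
  refine and_congr_right fun _ => and_congr_right fun _ => ?_
  constructor
  · rintro ⟨rs, hrs, hreg, hlen⟩
    have hlen : rs.length = 2 := by
      rw [hdim] at hlen
      exact_mod_cast hlen
    obtain ⟨a, b, rfl⟩ := List.length_eq_two.1 hlen
    exact ⟨a, hrs a (by simp), b, hrs b (by simp), (isWeaklyRegular_pair_iff a b).1 hreg.1⟩
  · rintro ⟨a, ha, b, hb, h⟩
    have hab : ∀ r ∈ [a, b], r ∈ maximalIdeal A := by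
      simpa only [List.mem_cons, List.not_mem_nil, or_false, forall_eq_or_imp, forall_eq] using
        ⟨ha, hb⟩
    exact ⟨[a, b], hab, (isRegular_iff_isWeaklyRegular_of_subset_maximalIdeal hab).2
      ((isWeaklyRegular_pair_iff a b).2 h), by rw [hdim]; rfl⟩

/-- The elements killed by `c ≠ 0` form a submodule `T` on which the regular pair stays regular. If
`T` were nonzero its support would have dimension at least two, while `T` is a module over `A /
(c)`, of dimension at most one. -/
theorem IsMCM.isTorsionFree {A M : Type u} [CommRing A] [IsDomain A] [IsLocalRing A]
    [IsNoetherianRing A] [AddCommGroup M] [Module A M] (hdim : ringKrullDim A = 2)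
    (h : IsMCM A M) : Module.IsTorsionFree A M := by
  obtain ⟨_, _, a, ha, b, hb, h1, h2⟩ := (isMCM_iff_of_ringKrullDim_eq_two hdim).1 h
  refine ⟨fun c hc => isSMulRegular_iff_right_eq_zero_of_smul.2 fun x hx => ?_⟩
  by_contra hx0
  let T : Submodule A M := LinearMap.ker (LinearMap.lsmul A M c)
  have hT : ∀ y, y ∈ T ↔ c • y = 0 := fun y => LinearMap.mem_ker
  have : Nontrivial T := ⟨⟨x, (hT x).2 hx⟩, 0, fun h => hx0 (congrArg Subtype.val h)⟩
  have hab : ∀ r ∈ [a, b], r ∈ maximalIdeal A := by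
      simpa only [List.mem_cons, List.not_mem_nil, or_false, forall_eq_or_imp, forall_eq] using
        ⟨ha, hb⟩
  have hreg : RingTheory.Sequence.IsRegular T [a, b] := by
    rw [isRegular_iff_isWeaklyRegular_of_subset_maximalIdeal hab, isWeaklyRegular_pair_iff]
    refine ⟨fun y hy => Subtype.ext (h1 y (congrArg Subtype.val hy)), fun y z hyz => ?_⟩
    obtain ⟨w, hw⟩ := h2 y z (congrArg Subtype.val hyz)
    refine ⟨⟨w, (hT w).2 (h1 _ ?_)⟩, Subtype.ext hw⟩
    rw [smul_comm, ← hw]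
    exact (hT y).1 y.2
  have hdimT := Module.supportDim_add_length_eq_supportDim_of_isRegular [a, b] hreg
  have hq : Nontrivial (T ⧸ Ideal.ofList [a, b] • (⊤ : Submodule A T)) :=
    Submodule.Quotient.nontrivial_iff.2 hreg.2.symm
  have h0 : (0 : WithBot ℕ∞) ≤ Module.supportDim A (T ⧸ Ideal.ofList [a, b] • (⊤ : Submodule A T)) := by
    obtain ⟨n, hn⟩ := WithBot.ne_bot_iff_exists.1 (Module.supportDim_ne_bot_of_nontrivial A
      (T ⧸ Ideal.ofList [a, b] • (⊤ : Submodule A T)))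
    rw [← hn]
    exact_mod_cast (zero_le : 0 ≤ n)
  have h3 : Module.supportDim A T ≤ ringKrullDim (A ⧸ Ideal.span {c}) := by
    rw [Module.supportDim_eq_ringKrullDim_quotient_annihilator]
    refine ringKrullDim_le_of_surjective (Ideal.Quotient.factor (?_ : Ideal.span {c} ≤ _))
      (Ideal.Quotient.factor_surjective _)
    rw [Ideal.span_singleton_le_iff_mem, Module.mem_annihilator]
    exact fun y => Subtype.ext ((hT y).1 y.2)
  have h4 := ringKrullDim_quotient_succ_le_of_nonZeroDivisor (mem_nonZeroDivisors_of_ne_zero hc.ne_zero)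
  have h5 : (2 : WithBot ℕ∞) ≤ Module.supportDim A T := by
    rw [← hdimT]
    exact le_add_of_nonneg_left h0
  have h6 : (2 : WithBot ℕ∞) + 1 ≤ 2 :=
    (add_le_add_left (h5.trans h3) 1).trans (h4.trans hdim.le)
  exact absurd h6 (by decide)

theorem IsMCM.of_isCompl {A M : Type u} [CommRing A] [IsLocalRing A] [AddCommGroup M] [Module A M]
    (hdim : ringKrullDim A = 2) (h : IsMCM A M) {N P : Submodule A M} (hNP : IsCompl N P)
    (hN : N ≠ ⊥) : IsMCM A N := by
  obtain ⟨_, _, a, ha, b, hb, h1, h2⟩ := (isMCM_iff_of_ringKrullDim_eq_two hdim).1 h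
  have hp := Submodule.projectionOnto_apply_left hNP
  refine (isMCM_iff_of_ringKrullDim_eq_two hdim).2
    ⟨Module.Finite.of_surjective (N.projectionOnto P hNP) fun x => ⟨x, hp x⟩,
      Submodule.nontrivial_iff_ne_bot.2 hN, a, ha, b, hb,
      fun x hx => Subtype.ext (h1 x (congrArg Subtype.val hx)), fun x y hxy => ?_⟩
  obtain ⟨z, hz⟩ := h2 x y (congrArg Subtype.val hxy)
  refine ⟨N.projectionOnto P hNP z, ?_⟩
  rw [← map_smul, ← hz, hp]

theorem IsMCM.baseChange {R S M : Type u} [CommRing R] [IsLocalRing R] [CommRing S] [IsLocalRing S]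
    [Algebra R S] [Module.Flat R S] [IsLocalHom (algebraMap R S)] [AddCommGroup M] [Module R M]
    (hRS : ringKrullDim R = ringKrullDim S) (h : IsMCM R M) : IsMCM S (S ⊗[R] M) := by
  have : Module.FaithfullyFlat R S := Module.FaithfullyFlat.of_flat_of_isLocalHom
  obtain ⟨_, _, rs, hrs, hreg, hlen⟩ := h
  refine ⟨inferInstance, inferInstance, rs.map (algebraMap R S), fun s hs => ?_,
    hreg.of_faithfullyFlat_of_isBaseChange (TensorProduct.isBaseChange R M S), ?_⟩
  · obtain ⟨r, hr, rfl⟩ := List.mem_map.1 hs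
    exact map_nonunit (algebraMap R S) r (hrs r hr)
  · rw [List.length_map, hlen, hRS]

theorem hasRank_iff_finrank_eq {A M : Type u} [CommRing A] [IsDomain A] [AddCommGroup M] [Module A M]
    [Module.Finite A M] (r : ℕ) : HasRank A M r ↔ Module.finrank A M = r := by
  rw [← (TensorProduct.isBaseChange A M (FractionRing A)).finrank_eq]
  constructor
  · rintro ⟨e⟩
    rw [e.finrank_eq, Module.finrank_fin_fun]
  · intro h
    exact ⟨(Module.finBasisOfFinrankEq _ _ h).equivFun⟩

theorem finrank_sup_le_sum {A X : Type u} [CommRing A] [IsDomain A] [IsNoetherianRing A]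
    [AddCommGroup X] [Module A X] [Module.Finite A X] (V : Finset (Submodule A X)) :
    Module.finrank A ↥(V.sup id) ≤ ∑ N ∈ V, Module.finrank A N := by
  classical
  induction V using Finset.induction with
  | empty => rw [Finset.sup_empty, finrank_bot, Finset.sum_empty]
  | insert N V hN ih =>
    rw [Finset.sup_insert, Finset.sum_insert hN]
    refine le_trans ?_ (Nat.add_le_add_left ih _)
    have := Submodule.rank_add_le_rank_add_rank N (V.sup id)
    rw [← Module.finrank_eq_rank, ← Module.finrank_eq_rank, ← Module.finrank_eq_rank] at this
    exact_mod_cast this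

theorem length_quotient_sup_le_sum {A X : Type u} [CommRing A] [AddCommGroup X] [Module A X]
    (I : Ideal A) (V : Finset (Submodule A X)) (hV : V.sup id = ⊤) :
    Module.length A (X ⧸ I • (⊤ : Submodule A X)) ≤
      ∑ N ∈ V, Module.length A (N ⧸ I • (⊤ : Submodule A N)) := by
  classical
  let f : ∀ N : V, (N.1 ⧸ I • (⊤ : Submodule A N.1)) →ₗ[A] X ⧸ I • (⊤ : Submodule A X) := fun N =>
    Submodule.mapQ _ _ N.1.subtype (by
      rw [← Submodule.map_le_iff_le_comap, Submodule.map_smul'']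
      exact Submodule.smul_mono le_rfl le_top)
  let F := LinearMap.lsum A (fun N : V => N.1 ⧸ I • (⊤ : Submodule A N.1)) A f
  have hF : Surjective F := by
    rw [← LinearMap.range_eq_top, eq_top_iff, ← Submodule.range_mkQ, ← Submodule.map_top,
      Submodule.map_le_iff_le_comap]
    refine hV.ge.trans (Finset.sup_le fun N hN x hx => ?_)
    refine ⟨Pi.single ⟨N, hN⟩ (Submodule.Quotient.mk ⟨x, hx⟩), ?_⟩
    rw [LinearMap.lsum_piSingle]
    rfl
  refine (Module.length_le_of_surjective F hF).trans_eq ?_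
  rw [Module.length_pi_of_fintype]
  exact Finset.sum_coe_sort V fun N => Module.length A (N ⧸ I • (⊤ : Submodule A N))

/-- Flat base change multiplies lengths by the length of `S / 𝔪_R S`, which is at least `1`, and `S
⊗ (M / 𝔪_R ^ n M)` is a quotient of the module on the right. -/
theorem length_quotient_pow_le {R S M : Type u} [CommRing R] [IsLocalRing R]
    [CommRing S] [IsLocalRing S] [Algebra R S] [Module.Flat R S] [IsCompletionLike R S]
    [AddCommGroup M] [Module R M] (n : ℕ) :
    Module.length R (M ⧸ maximalIdeal R ^ n • (⊤ : Submodule R M)) ≤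
      Module.length S ((S ⊗[R] M) ⧸ maximalIdeal S ^ n • (⊤ : Submodule S (S ⊗[R] M))) := by
  have := IsCompletionLike.isLocalHom R S
  set Q := M ⧸ maximalIdeal R ^ n • (⊤ : Submodule R M)
  have h1 : Module.length R Q ≤ Module.length S (S ⊗[R] Q) := by
    rw [IsLocalRing.length_baseChange, IsCompletionLike.map_maximalIdeal]
    refine le_mul_of_one_le_right zero_le ?_
    rw [Order.one_le_iff_ne_zero]
    exact Module.length_pos.ne'
  refine h1.trans ?_
  let q : S ⊗[R] M →ₗ[S] S ⊗[R] Q := (Submodule.mkQ _).baseChange S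
  have hq : Surjective q := LinearMap.lTensor_surjective S (Submodule.mkQ_surjective _)
  refine Module.length_le_of_surjective ((maximalIdeal S ^ n • (⊤ : Submodule S (S ⊗[R] M))).liftQ q
    ?_) ?_
  · rw [← IsCompletionLike.map_pow_maximalIdeal R S n, Submodule.smul_le]
    intro s hs x _
    rw [LinearMap.mem_ker, map_smul]
    induction hs using Submodule.span_induction with
    | zero => rw [zero_smul]
    | add a b _ _ ha hb => rw [add_smul, ha, hb, add_zero]
    | smul a b _ hb => rw [smul_assoc, hb, smul_zero]
    | mem s hs =>
      obtain ⟨r, hr, rfl⟩ := hs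
      rw [algebraMap_smul]
      generalize q x = y
      induction y with
      | zero => rw [smul_zero]
      | add y z hy hz => rw [smul_add, hy, hz, add_zero]
      | tmul s y =>
        obtain ⟨y, rfl⟩ := Submodule.Quotient.mk_surjective _ y
        rw [← tmul_smul, ← Submodule.Quotient.mk_smul,
          (Submodule.Quotient.mk_eq_zero _).2 (Submodule.smul_mem_smul hr (Submodule.mem_top)),
          tmul_zero]
  · intro y
    obtain ⟨x, rfl⟩ := hq y
    exact ⟨Submodule.Quotient.mk x, rfl⟩

open scoped ENNReal in
theorem hilbertSamuelMultiplicity_le_card_mul {R S M X : Type u} [CommRing R] [IsLocalRing R]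
    [CommRing S] [IsLocalRing S] (hRS : ringKrullDim R = ringKrullDim S) [AddCommGroup M]
    [Module R M] [AddCommGroup X] [Module S X]
    (hMX : ∀ n : ℕ, Module.length R (M ⧸ maximalIdeal R ^ n • (⊤ : Submodule R M)) ≤
      Module.length S (X ⧸ maximalIdeal S ^ n • (⊤ : Submodule S X)))
    (V : Finset (Submodule S X)) (hV : V.sup id = ⊤) (b : ℕ)
    (hb : ∀ N ∈ V, hilbertSamuelMultiplicity S N ≤ b) :
    hilbertSamuelMultiplicity R M ≤ V.card * ((b : ℝ≥0∞) + 1) := by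
  unfold hilbertSamuelMultiplicity at hb ⊢
  rw [hRS]
  set d := ((ringKrullDim S).unbotD 0).toNat
  simp only at hb ⊢
  -- An upper limit at most `b` gives the eventual bound only with some slack, hence `b + 1`. The
  -- finitely many eventual bounds are then added.
  have hev : ∀ N ∈ V, ∀ᶠ n : ℕ in Filter.atTop, (d.factorial : ℝ≥0∞) *
      ((Module.length S (N ⧸ (maximalIdeal S ^ n • (⊤ : Submodule S N))) : ℕ∞) : ℝ≥0∞)
        / (n : ℝ≥0∞) ^ d < (b : ℝ≥0∞) + 1 := by
    intro N hN
    refine Filter.eventually_lt_of_limsup_lt ((hb N hN).trans_lt ?_)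
    exact ENNReal.lt_add_right (by simp) one_ne_zero
  refine Filter.limsup_le_of_le (h := ?_)
  filter_upwards [(Filter.eventually_all_finset V).2 hev] with n hn
  calc _ ≤ (d.factorial : ℝ≥0∞) *
        ((∑ N ∈ V, Module.length S (N ⧸ (maximalIdeal S ^ n • (⊤ : Submodule S N))) : ℕ∞) : ℝ≥0∞)
          / (n : ℝ≥0∞) ^ d := by
        gcongr
        exact (hMX n).trans (length_quotient_sup_le_sum _ V hV)
    _ = ∑ N ∈ V, (d.factorial : ℝ≥0∞) *
        ((Module.length S (N ⧸ (maximalIdeal S ^ n • (⊤ : Submodule S N))) : ℕ∞) : ℝ≥0∞)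
          / (n : ℝ≥0∞) ^ d := by
        simp only [div_eq_mul_inv]
        rw [← Finset.sum_mul, ← Finset.mul_sum]
        congr 2
        exact map_sum ENat.toENNRealRingHom _ _
    _ ≤ ∑ N ∈ V, ((b : ℝ≥0∞) + 1) := Finset.sum_le_sum fun N hN => (hn N hN).le
    _ = _ := by rw [Finset.sum_const, nsmul_eq_mul]

theorem mcmRankBound_and_hasBoundedCMType_of_isCompletionLike {R S : Type u} [CommRing R] [IsDomain R]
    [IsLocalRing R] [IsNoetherianRing R] [IsIntegrallyClosed R] [CommRing S] [IsDomain S]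
    [IsLocalRing S] [IsNoetherianRing S] [IsIntegrallyClosed S] [Algebra R S] [Module.Flat R S]
    [IsCompletionLike R S] (hR : ringKrullDim R = 2) (hS : ringKrullDim S = 2)
    [Finite (DivisorClassCokernel R S)] :
    (∀ n : ℕ, MCMRankBound S n →
      MCMRankBound R (n * davenportConstant (DivisorClassCokernel R S))) ∧
    (HasBoundedCMType S → HasBoundedCMType R) := by
  have := IsCompletionLike.isLocalHom R S
  have := IsCompletionLike.faithfullyFlat R S
  have hRS : ringKrullDim R = ringKrullDim S := hR.trans hS.symm
  -- The base change is MCM, hence torsion-free, and its direct summands inherit the regular pair.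
  have key : ∀ (M : Type u) [AddCommGroup M] [Module R M], IsMCM R M → IsIndecomposableModule R M →
      ∃ V : Finset (Submodule S (S ⊗[R] M)), V.sup id = ⊤ ∧
        V.card ≤ davenportConstant (DivisorClassCokernel R S) ∧
        ∀ N ∈ V, IsMCM S N ∧ IsIndecomposableModule S N := by
    classical
    intro M _ _ hM hM'
    have := hM.1
    have hX : IsMCM S (S ⊗[R] M) := hM.baseChange hRS
    have := hX.isTorsionFree hS
    obtain ⟨V, hV, hV', hind⟩ := exists_isIndecomposableModule_decomposition S (S ⊗[R] M)
    have hbot : ∀ N ∈ V, N ≠ ⊥ := fun N hN => Submodule.nontrivial_iff_ne_bot.1 (hind N hN).1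
    refine ⟨V, hV', card_le_davenportConstant hR hS hM' V hV hV' hbot, fun N hN =>
      ⟨hX.of_isCompl hS (P := (V.erase N).sup id)
        ⟨hV (Finset.erase_subset _ _) hN (Finset.notMem_erase _ _), ?_⟩ (hbot N hN), hind N hN⟩⟩
    have h1 := Finset.sup_insert (f := id) (b := N) (s := V.erase N)
    rw [Finset.insert_erase hN, hV'] at h1
    exact codisjoint_iff.2 h1.symm
  constructor
  · intro n hn M _ _ hM hM'
    have := hM.1
    obtain ⟨V, hV, hcard, hV'⟩ := key M hM hM'
    refine ⟨_, ?_, (hasRank_iff_finrank_eq _).2 rfl⟩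
    rw [← (TensorProduct.isBaseChange R M S).finrank_eq, ← finrank_top S (S ⊗[R] M), ← hV]
    refine (finrank_sup_le_sum V).trans ((Finset.sum_le_card_nsmul V _ n fun N hN => ?_).trans ?_)
    · obtain ⟨h1, h2⟩ := hV' N hN
      obtain ⟨r, hr, hr'⟩ := hn N h1 h2
      have := h1.1
      rwa [(hasRank_iff_finrank_eq r).1 hr']
    · rw [smul_eq_mul, mul_comm]
      exact Nat.mul_le_mul_left n hcard
  · rintro ⟨b, hb⟩
    refine ⟨davenportConstant (DivisorClassCokernel R S) * (b + 1), fun M _ _ hM hM' => ?_⟩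
    obtain ⟨V, hV, hcard, hV'⟩ := key M hM hM'
    refine (hilbertSamuelMultiplicity_le_card_mul hRS length_quotient_pow_le V hV b fun N hN =>
      hb N (hV' N hN).1 (hV' N hN).2).trans ?_
    push_cast
    gcongr

end MaximalCohenMacaulay

/-! ### The completion of a Noetherian local ring. -/

section Completion

open IsLocalRing Function

/-- Since `φ` sends `J ^ n` into `K ^ n`, it induces compatible maps from the completion to the
quotients `B ⧸ K ^ n`, and `B` is their limit. -/
theorem AdicCompletion.exists_ringHom_comp_algebraMap_eq {P B : Type*} [CommRing P] [CommRing B]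
    (J : Ideal P) (K : Ideal B) [IsAdicComplete K B] (φ : P →+* B) (h : J ≤ K.comap φ) :
    ∃ F : AdicCompletion J P →+* B, F.comp (algebraMap P (AdicCompletion J P)) = φ := by
  have hpow : ∀ n : ℕ, J ^ n ≤ (K ^ n).comap φ := fun n =>
    (Ideal.pow_right_mono h n).trans (Ideal.le_comap_pow φ n)
  let f : ∀ n : ℕ, AdicCompletion J P →+* B ⧸ K ^ n := fun n =>
    (Ideal.quotientMap (K ^ n) φ (hpow n)).comp (AdicCompletion.evalₐ J n).toRingHom
  have hf : ∀ {m n : ℕ} (hle : m ≤ n), (Ideal.Quotient.factorPow K hle).comp (f n) = f m := by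
    intro m n hle
    refine RingHom.ext fun x => ?_
    obtain ⟨x, rfl⟩ := AdicCompletion.mk_surjective J P x
    change Ideal.Quotient.factorPow K hle (Ideal.quotientMap (K ^ n) φ (hpow n)
      (AdicCompletion.evalₐ J n (AdicCompletion.mk J P x))) =
      Ideal.quotientMap (K ^ m) φ (hpow m) (AdicCompletion.evalₐ J m (AdicCompletion.mk J P x))
    rw [AdicCompletion.evalₐ_mk, AdicCompletion.evalₐ_mk, Ideal.quotientMap_mk,
      Ideal.quotientMap_mk]
    change Ideal.Quotient.mk (K ^ m) (φ (x.val n)) = _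
    rw [Ideal.Quotient.eq, ← map_sub]
    refine hpow m ?_
    have := (x.property hle).symm
    rw [SModEq.sub_mem, smul_eq_mul, Ideal.mul_top] at this
    exact this
  refine ⟨IsAdicComplete.liftRingHom K f hf, RingHom.ext fun x => ?_⟩
  refine (IsHausdorff.eq_iff_smodEq (I := K)).2 fun n => ?_
  rw [smul_eq_mul, Ideal.mul_top, SModEq.sub_mem, ← Ideal.Quotient.eq, RingHom.comp_apply,
    IsAdicComplete.mk_liftRingHom]
  change Ideal.quotientMap (K ^ n) φ (hpow n) (AdicCompletion.evalₐ J n (algebraMap P _ x)) = _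
  rw [AlgHom.commutes]
  rfl

/-- `B` is a quotient of a power series ring over `A`, the variables going to generators of `K`. The
power series ring appears as the completion of the polynomial ring; constants already give
surjectivity modulo `K`, and completeness lifts it to `B`. -/
theorem isNoetherianRing_of_isAdicComplete {A B : Type*} [CommRing A] [IsNoetherianRing A]
    [CommRing B] (g : A →+* B) (K : Ideal B) [IsAdicComplete K B] (hK : K.FG)
    (hg : ∀ b, ∃ a, b - g a ∈ K) : IsNoetherianRing B := by
  obtain ⟨k, a, ha⟩ := Submodule.fg_iff_exists_fin_generating_family.1 hK
  let P := MvPolynomial (Fin k) A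
  let J : Ideal P := MvPolynomial.idealOfVars (Fin k) A
  let φ : P →+* B := MvPolynomial.eval₂Hom g a
  have hJ : J.map φ = K := by
    change (Ideal.span _).map φ = K
    rw [Ideal.map_span, ← ha]
    congr 1
    rw [← Set.range_comp]
    congr 1
    exact funext fun i => MvPolynomial.eval₂Hom_X' g a i
  obtain ⟨F, hF⟩ := AdicCompletion.exists_ringHom_comp_algebraMap_eq J K φ (Ideal.map_le_iff_le_comap.1 hJ.le)
  have := AdicCompletion.isAdicComplete_self J (MvPolynomial.idealOfVars_fg (Fin k) A)
  have hmap : (J.map (algebraMap P (AdicCompletion J P))).map F = K := by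
    rw [Ideal.map_map, hF, hJ]
  have : IsHausdorff ((J.map (algebraMap P (AdicCompletion J P))).map F) B := by
    rw [hmap]; infer_instance
  have hsurj : Surjective F := by
    refine surjective_of_mk_map_comp_surjective (I := J.map (algebraMap P (AdicCompletion J P))) F
      fun b => ?_
    obtain ⟨b, rfl⟩ := Ideal.Quotient.mk_surjective b
    obtain ⟨r, hr⟩ := hg b
    refine ⟨algebraMap P (AdicCompletion J P) (MvPolynomial.C r), ?_⟩
    rw [RingHom.comp_apply, ← RingHom.comp_apply F, hF, eq_comm, Ideal.Quotient.eq, hmap]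
    rwa [show φ (MvPolynomial.C r) = g r from MvPolynomial.eval₂Hom_C g a r]
  have : IsNoetherianRing (AdicCompletion J P) :=
    isNoetherianRing_of_ringEquiv _ (MvPowerSeries.toAdicCompletionAlgEquiv (Fin k) A).toRingEquiv
  exact isNoetherianRing_of_surjective _ _ F hsurj

variable (R : Type u) [CommRing R] [IsLocalRing R] [IsNoetherianRing R]

instance isCompletionLike_localCompletion : IsCompletionLike R (LocalCompletion R) where
  map_maximalIdeal := AdicCompletion.maximalIdeal_eq_map.symm
  exists_sub_mem s := by
    obtain ⟨r, hr⟩ := (AdicCompletion.residueField_map_bijective R).2 (residue _ s)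
    obtain ⟨r, rfl⟩ := residue_surjective r
    rw [ResidueField.map_residue] at hr
    exact ⟨r, (Ideal.Quotient.eq.1 hr.symm)⟩

instance isNoetherianRing_localCompletion : IsNoetherianRing (LocalCompletion R) := by
  refine isNoetherianRing_of_isAdicComplete (algebraMap R (LocalCompletion R))
    (maximalIdeal (LocalCompletion R)) ?_ (IsCompletionLike.exists_sub_mem (R := R))
  rw [AdicCompletion.maximalIdeal_eq_map]
  exact (maximalIdeal R).fg_of_isNoetherianRing.map _

/-- Going down for flat maps gives the height of `𝔪_S` as that of `𝔪_R` plus that of the maximal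
ideal of the closed fibre `S / 𝔪_R S`, which is zero. -/
theorem IsCompletionLike.ringKrullDim_eq (S : Type u) [CommRing S] [IsLocalRing S]
    [IsNoetherianRing S] [Algebra R S] [Module.Flat R S] [IsCompletionLike R S] :
    ringKrullDim S = ringKrullDim R := by
  have := IsCompletionLike.isLocalHom R S
  have : (maximalIdeal S).LiesOver (maximalIdeal R) :=
    ⟨(maximalIdeal_comap (algebraMap R S)).symm⟩
  have h := Ideal.height_eq_height_add_of_liesOver_of_hasGoingDown (maximalIdeal R) (maximalIdeal S)
  rw [IsCompletionLike.map_maximalIdeal, Ideal.map_quotient_self, Ideal.height_bot, add_zero] at h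
  rw [← maximalIdeal_height_eq_ringKrullDim, ← maximalIdeal_height_eq_ringKrullDim, h]

end Completion

theorem proposition3p6 {R : Type u} [CommRing R] [IsDomain R] [IsLocalRing R] [IsNoetherianRing R]
    [IsIntegrallyClosed R] (hdim : ringKrullDim R = 2)
    [IsDomain (LocalCompletion R)] [IsIntegrallyClosed (LocalCompletion R)]
    (hfin : Finite (DivisorClassCokernel R (LocalCompletion R))) :
    (∀ n : ℕ, MCMRankBound (LocalCompletion R) n →
      MCMRankBound R (n * davenportConstant (DivisorClassCokernel R (LocalCompletion R)))) ∧
    (HasBoundedCMType (LocalCompletion R) → HasBoundedCMType R) := by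
  exact mcmRankBound_and_hasBoundedCMType_of_isCompletionLike hdim
    ((IsCompletionLike.ringKrullDim_eq R (LocalCompletion R)).trans hdim)
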